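/- For $\pi\in S_n$, let $\mathsf{runsort}(\pi)\in S_n$ be the permutation obtained from $\pi$ by rearranging its ascending runs (maximal consecutive increasing subsequences) so that their smallest entries appear in increasing order. For $\sigma\in S_n$, let $\gamma_\sigma$ be the measure on $[0,1]^2$ that has density $n$ on $\bigcup_{i=1}^n\left[\frac{i-1}n,\frac in\right)\times\left[\frac{\sigma_i-1}n,\frac{\sigma_i}n\right)$ and density $0$ elsewhere. Let $\pi$ be uniformly distributed in $S_n$, let $p_n(i,j)$ be the probability that $\mathsf{runsort}(\pi)$ has the entry $j$ in position $i$, and for $B=[x_1,x_2]\times[y_1,y_2]\subseteq[0,1]^2$ put $$E_n(B)=\frac1n\sum_{\substack{x_1n<i\le x_2n\\ y_1n<j\le y_2n}}p_n(i,j).$$ Let $\mathbf R_n=\mathbb E[\gamma_{\mathsf{runsort}(\pi)}]$ be the expected measure; thus $\mathbf R_n(B)=E_n(B)$ for every rectangle $B$ whose vertices have coordinates that are integer multiples of $1/n$. Let $\mathcal C=\{(x,y)\in[0,1]^2:x=ye^{1-y}\}$ and $\mathcal C^+=\{(x,y)\in[0,1]^2:x<ye^{1-y}\}$, and let $\mathbf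 R$ be the measure $$\mathbf R(B)=\int_{B\cap\mathcal C^+}e^{y-1}\,dx\,dy+\int_{B\cap\mathcal C}(1-y)\,dy,$$ where in the second integral the curve $\mathcal C$ is parametrized by $y\in[0,1]$. Theorem. The measures $\mathbf R_n$ converge to $\mathbf R$ as $n\to\infty$. That is, for every axis-parallel rectangle $B=[x_1,x_2]\times[y_1,y_2]\subseteq[0,1]^2$, $$\lim_{n\to\infty}E_n(B)=\lim_{n\to\infty}\mathbf R_n(B)=\mathbf R(B),$$ and moreover $d_\square(\mathbf R_n,\mathbf R)=\sup_B|\mathbf R_n(B)-\mathbf R(B)|\to0$, where the supremum is over all such rectangles $B$. -/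

import Mathlib

namespace RunsortPermuton

open MeasureTheory Set Filter Topology
open scoped ENNReal

/-! Permutations of `[n]` are `Equiv.Perm (Fin n)`: position `i` and value `π i` of `Fin n` stand for
the position `i + 1` and the entry `π i + 1` of the usual one-line notation. -/

/-- The positions of the ascending run of `π` (maximal block of consecutive positions along which `π`
increases) that contains the position `i`: all `j` such that `π` increases on all the positions
between `i` and `j`, both included. -/
def run {n : ℕ} (π : Equiv.Perm (Fin n)) (i : Fin n) : Finset (Fin n) :=
  Finset.univ.filter fun j =>
    ∀ a ∈ Finset.uIcc i j, ∀ b ∈ Finset.uIcc i j, a < b → π a < π b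

theorem self_mem_run {n : ℕ} (π : Equiv.Perm (Fin n)) (i : Fin n) : i ∈ run π i := by
  simp only [run, Finset.mem_filter, Finset.mem_univ, true_and, Finset.uIcc_self,
    Finset.mem_singleton]
  rintro a rfl b rfl h
  exact absurd h (lt_irrefl _)

/-- The smallest entry of the run of `π` that contains the position `i`. -/
def runMin {n : ℕ} (π : Equiv.Perm (Fin n)) (i : Fin n) : Fin n :=
  (run π i).inf' ⟨i, self_mem_run π i⟩ π

/-- `runsort π`: the runs of `π` are rearranged so that their smallest entries appear in increasing
order, the order inside each run being kept. (`Tuple.sort` is the stable sort: it lists the positions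
`i` in the lexicographic order of the pairs `(runMin π i, i)`.) -/
def runsort {n : ℕ} (π : Equiv.Perm (Fin n)) : Equiv.Perm (Fin n) :=
  π * Tuple.sort (runMin π)

/-- The measure `γ_π` on the unit square (as a measure on the plane): its density is `n` on the
`n` cells `[i/n, (i+1)/n) × [π i/n, (π i + 1)/n)`, `i = 0, …, n - 1`, and `0` elsewhere. -/
noncomputable def gamma {n : ℕ} (π : Equiv.Perm (Fin n)) : Measure (ℝ × ℝ) :=
  volume.withDensity
    ((⋃ i : Fin n,
      Ico ((i : ℝ) / n) (((i : ℝ) + 1) / n) ×ˢ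
        Ico ((π i : ℝ) / n) (((π i : ℝ) + 1) / n)).indicator fun _ => (n : ℝ≥0∞))

/-- The probability that `runsort π` has the entry `j` in position `i`, for `π` uniform in `S_n`. -/
noncomputable def p (n : ℕ) (i j : Fin n) : ℝ :=
  ((Finset.univ.filter fun π : Equiv.Perm (Fin n) => runsort π i = j).card : ℝ) / n.factorial

open Classical in
/-- `E_n([x₁, x₂] × [y₁, y₂])`: `1/n` times the sum of the probabilities that the entry `j` is in
position `i`, over `x₁ n < i ≤ x₂ n` and `y₁ n < j ≤ y₂ n` (`i, j` counted from `1`). -/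
noncomputable def E (n : ℕ) (x₁ x₂ y₁ y₂ : ℝ) : ℝ :=
  1 / (n : ℝ) * ∑ i : Fin n, ∑ j : Fin n,
    if (x₁ * n < (i : ℝ) + 1 ∧ (i : ℝ) + 1 ≤ x₂ * n) ∧
        (y₁ * n < (j : ℝ) + 1 ∧ (j : ℝ) + 1 ≤ y₂ * n)
    then p n i j else 0

/-- The expectation of the random measure `γ_{runsort π}`, for `π` uniform in `S_n`. -/
noncomputable def meanMeasure (n : ℕ) : Measure (ℝ × ℝ) :=
  (n.factorial : ℝ≥0∞)⁻¹ • ∑ π : Equiv.Perm (Fin n), gamma (runsort π)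

/-- The region `C⁺ = {(x, y) ∈ [0,1]² : x < y e^{1-y}}`. -/
def Cplus : Set (ℝ × ℝ) :=
  {q | q ∈ Icc (0 : ℝ) 1 ×ˢ Icc (0 : ℝ) 1 ∧ q.1 < q.2 * Real.exp (1 - q.2)}

/-- The runsort permuton: the sum of the measure with density `e^{y-1}` on `C⁺` and of the measure
`(1 - y) dy` on the curve `C = {(x, y) ∈ [0,1]² : x = y e^{1-y}}`, which is parametrized by
`y ∈ [0,1]`. -/
noncomputable def R : Measure (ℝ × ℝ) :=
  (volume.restrict Cplus).withDensity (fun q => ENNReal.ofReal (Real.exp (q.2 - 1))) +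
  ((volume.restrict (Icc (0 : ℝ) 1)).withDensity (fun y => ENNReal.ofReal (1 - y))).map
    (fun y : ℝ => (y * Real.exp (1 - y), y))

/-- Axis-parallel rectangles in the unit square. -/
def IsRect (B : Set (ℝ × ℝ)) : Prop :=
  ∃ x₁ x₂ y₁ y₂ : ℝ, 0 ≤ x₁ ∧ x₁ ≤ x₂ ∧ x₂ ≤ 1 ∧ 0 ≤ y₁ ∧ y₁ ≤ y₂ ∧ y₂ ≤ 1 ∧
    B = Icc x₁ x₂ ×ˢ Icc y₁ y₂

/-- The rectangle distance `d_□(γ₁, γ₂) = sup_B |γ₁(B) - γ₂(B)|` of finite measures. -/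
noncomputable def dSquare (γ₁ γ₂ : Measure (ℝ × ℝ)) : ℝ≥0∞ :=
  ⨆ (B : Set (ℝ × ℝ)) (_ : IsRect B), ENNReal.ofReal |γ₁.real B - γ₂.real B|

end RunsortPermuton

/-! Let `L m b` be the number of entries less than `b` in the runs of `π` with minimum below `m`.
Since `runsort` puts the runs with smaller minima first, these are the entries less than `b` among
the first `L m n` entries of `runsort π`, so the joint distribution function of `runsort π` is
determined by `L`.

Whether a position contributes to `L m b` is decided by reading `π` backwards from it: the entries,
the first one being less than `b`, have to decrease until one less than `m` is met. In a window of
bounded length the entries are asymptotically independent uniform letters. For these, the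
probability `p b` that the position contributes satisfies `p b = (1 / n) ∑ u < b, p u` for `b ≥ m`,
where `p u = 1` for `u < m`; hence `p b = (m / n) (1 + 1 / n) ^ (b - m)`, which tends to
`s e^(t - s)` for `m ∼ s n` and `b ∼ t n`. Disjoint windows are asymptotically independent as well,
so the second moment method shows that `L m b / n` concentrates at this value. In particular
`L m n / n → s e^(1 - s)`, so for `s ≤ t` the mean distribution function tends to `s e^(t - s)` at
`(s e^(1 - s), t)`, and to `t` for `t ≤ s`; this is the distribution function of `R`.

Distribution functions of measures with uniform marginals are `1`-Lipschitz in each variable, so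
the pointwise convergence is uniform, which controls all rectangles simultaneously. -/

namespace RunsortPermuton

open MeasureTheory Set Filter Topology
open scoped ENNReal BigOperators

/-- A permuton: a measure on the plane whose two marginals are uniform on `[0, 1]`. -/
structure IsPermuton (μ : Measure (ℝ × ℝ)) : Prop where
  measurePreserving_fst : MeasurePreserving Prod.fst μ (volume.restrict (Icc 0 1))
  measurePreserving_snd : MeasurePreserving Prod.snd μ (volume.restrict (Icc 0 1))

/-- The joint distribution function of a measure on the plane. -/
noncomputable def jointCdf (μ : Measure (ℝ × ℝ)) (x y : ℝ) : ℝ := μ.real (Iic x ×ˢ Iic y)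

theorem measureReal_preimage_uIoc_le {α : Type*} [MeasurableSpace α] {μ : Measure α} {f : α → ℝ}
    {s : Set ℝ} (hf : MeasurePreserving f μ (volume.restrict s)) (a b : ℝ) :
    μ.real (f ⁻¹' uIoc a b) ≤ |a - b| := by
  rw [hf.measureReal_preimage measurableSet_uIoc.nullMeasurableSet,
    measureReal_restrict_apply measurableSet_uIoc]
  calc volume.real (uIoc a b ∩ s)
    _ ≤ volume.real (uIoc a b) :=
      measureReal_mono inter_subset_left (by simp [uIoc])
    _ = |a - b| := by rw [uIoc, Real.volume_real_Ioc_of_le min_le_max, max_sub_min_eq_abs']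

namespace IsPermuton

variable {μ : Measure (ℝ × ℝ)}

theorem isProbabilityMeasure (h : IsPermuton μ) : IsProbabilityMeasure μ := by
  have := h.measurePreserving_fst.measure_preimage (nullMeasurableSet_univ)
  exact ⟨by simpa using this⟩

theorem abs_jointCdf_sub_le (h : IsPermuton μ) (x y x' y' : ℝ) :
    |jointCdf μ x y - jointCdf μ x' y'| ≤ |x - x'| + |y - y'| := by
  have := h.isProbabilityMeasure
  have hsub : symmDiff (Iic x ×ˢ Iic y) (Iic x' ×ˢ Iic y') ⊆
      Prod.fst ⁻¹' uIoc x x' ∪ Prod.snd ⁻¹' uIoc y y' := by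
    rintro ⟨a, b⟩
    simp only [mem_symmDiff, mem_prod, mem_Iic, mem_union, mem_preimage, mem_uIoc]
    grind
  have hmeas (u v : ℝ) : NullMeasurableSet (Iic u ×ˢ Iic v) μ :=
    (measurableSet_Iic.prod measurableSet_Iic).nullMeasurableSet
  calc |jointCdf μ x y - jointCdf μ x' y'|
    _ ≤ μ.real (symmDiff (Iic x ×ˢ Iic y) (Iic x' ×ˢ Iic y')) :=
      abs_measureReal_sub_le_measureReal_symmDiff (hmeas x y) (hmeas x' y')
    _ ≤ μ.real (Prod.fst ⁻¹' uIoc x x' ∪ Prod.snd ⁻¹' uIoc y y') := measureReal_mono hsub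
    _ ≤ μ.real (Prod.fst ⁻¹' uIoc x x') + μ.real (Prod.snd ⁻¹' uIoc y y') :=
      measureReal_union_le _ _
    _ ≤ |x - x'| + |y - y'| :=
      add_le_add (measureReal_preimage_uIoc_le h.measurePreserving_fst x x')
        (measureReal_preimage_uIoc_le h.measurePreserving_snd y y')

theorem real_Icc_prod_Icc (h : IsPermuton μ) {x₁ x₂ y₁ y₂ : ℝ} (hx : x₁ ≤ x₂) (hy : y₁ ≤ y₂) :
    μ.real (Icc x₁ x₂ ×ˢ Icc y₁ y₂) =
      jointCdf μ x₂ y₂ - jointCdf μ x₁ y₂ - jointCdf μ x₂ y₁ + jointCdf μ x₁ y₁ := by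
  have := h.isProbabilityMeasure
  have hIoc : (Icc x₁ x₂ ×ˢ Icc y₁ y₂ : Set (ℝ × ℝ)) =ᵐ[μ] Ioc x₁ x₂ ×ˢ Ioc y₁ y₂ := by
    rw [Set.prod_eq, Set.prod_eq]
    exact ae_eq_set_inter
      (h.measurePreserving_fst.quasiMeasurePreserving.preimage_ae_eq
        (ae_restrict_of_ae Ioc_ae_eq_Icc.symm))
      (h.measurePreserving_snd.quasiMeasurePreserving.preimage_ae_eq
        (ae_restrict_of_ae Ioc_ae_eq_Icc.symm))
  have hunion : (Iic x₁ ×ˢ Iic y₂ ∪ Iic x₂ ×ˢ Iic y₁) ∪ Ioc x₁ x₂ ×ˢ Ioc y₁ y₂ =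
      Iic x₂ ×ˢ Iic y₂ := by
    ext ⟨a, b⟩
    simp only [mem_union, mem_prod, mem_Iic, mem_Ioc]
    grind
  have hinter : Iic x₁ ×ˢ Iic y₂ ∩ Iic x₂ ×ˢ Iic y₁ = Iic x₁ ×ˢ Iic y₁ := by
    rw [prod_inter_prod, Iic_inter_Iic, Iic_inter_Iic, min_eq_left hx, min_eq_right hy]
  have hdisj : Disjoint (Iic x₁ ×ˢ Iic y₂ ∪ Iic x₂ ×ˢ Iic y₁) (Ioc x₁ x₂ ×ˢ Ioc y₁ y₂) := by
    rw [disjoint_union_left, Set.disjoint_prod, Set.disjoint_prod]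
    exact ⟨.inl (Iic_disjoint_Ioc le_rfl), .inr (Iic_disjoint_Ioc le_rfl)⟩
  have hadd := measureReal_union (μ := μ) hdisj (measurableSet_Ioc.prod measurableSet_Ioc)
  have hincl := measureReal_union_add_inter (μ := μ) (s := Iic x₁ ×ˢ Iic y₂)
    (measurableSet_Iic.prod measurableSet_Iic : MeasurableSet (Iic x₂ ×ˢ Iic y₁))
  rw [hunion] at hadd
  rw [hinter] at hincl
  rw [measureReal_congr hIoc]
  simp only [jointCdf]
  linarith

theorem average {ι : Type*} [Fintype ι] [Nonempty ι] {μs : ι → Measure (ℝ × ℝ)}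
    (h : ∀ i, IsPermuton (μs i)) :
    IsPermuton ((Fintype.card ι : ℝ≥0∞)⁻¹ • ∑ i, μs i) := by
  have hpres {f : ℝ × ℝ → ℝ} {ν : Measure ℝ} (hf : ∀ i, MeasurePreserving f (μs i) ν) :
      MeasurePreserving f ((Fintype.card ι : ℝ≥0∞)⁻¹ • ∑ i, μs i) ν := by
    have hmeas : Measurable f := (hf (Classical.arbitrary ι)).measurable
    refine ⟨hmeas, ?_⟩
    simp only [Measure.map_smul, Measure.map_finset_sum hmeas.aemeasurable, (hf _).map_eq,
      Finset.sum_const, Finset.card_univ, ← Nat.cast_smul_eq_nsmul ℝ≥0∞, smul_smul]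
    rw [ENNReal.inv_mul_cancel (by simp) (by simp), one_smul]
  exact ⟨hpres fun i => (h i).measurePreserving_fst, hpres fun i => (h i).measurePreserving_snd⟩

variable {ι : Type*} {l : Filter ι} {μs : ι → Measure (ℝ × ℝ)}

theorem tendstoUniformly_jointCdf (hμs : ∀ i, IsPermuton (μs i))
    (hlim : ∀ x ∈ Icc (0 : ℝ) 1, ∀ y ∈ Icc (0 : ℝ) 1,
      Tendsto (fun i => jointCdf (μs i) x y) l (𝓝 (jointCdf μ x y))) :
    TendstoUniformly (fun i (q : Icc (0 : ℝ) 1 × Icc (0 : ℝ) 1) => jointCdf (μs i) q.1 q.2)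
      (fun q => jointCdf μ q.1 q.2) l := by
  have hlip (i : ι) : LipschitzWith 2
      (fun q : Icc (0 : ℝ) 1 × Icc (0 : ℝ) 1 => jointCdf (μs i) q.1 q.2) := by
    refine LipschitzWith.of_dist_le_mul fun q q' => ((hμs i).abs_jointCdf_sub_le _ _ _ _).trans ?_
    have h₁ : |(q.1 : ℝ) - q'.1| ≤ dist q q' := le_max_left _ _
    have h₂ : |(q.2 : ℝ) - q'.2| ≤ dist q q' := le_max_right _ _
    simpa [two_mul] using add_le_add h₁ h₂
  have hequi := (LipschitzWith.uniformEquicontinuous _ 2 hlip).equicontinuous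
  have := (hequi.tendsto_uniformFun_iff_pi l fun q => jointCdf μ q.1 q.2).2
    (tendsto_pi_nhds.2 fun q => hlim _ q.1.2 _ q.2.2)
  exact UniformFun.tendsto_iff_tendstoUniformly.1 this

theorem tendsto_dSquare (hμ : IsPermuton μ) (hμs : ∀ i, IsPermuton (μs i))
    (hlim : ∀ x ∈ Icc (0 : ℝ) 1, ∀ y ∈ Icc (0 : ℝ) 1,
      Tendsto (fun i => jointCdf (μs i) x y) l (𝓝 (jointCdf μ x y))) :
    Tendsto (fun i => dSquare (μs i) μ) l (𝓝 0) := by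
  refine tendsto_order.2 ⟨by simp, fun ε hε => ?_⟩
  obtain ⟨δ, -, hδε⟩ := ENNReal.lt_iff_exists_real_btwn.1 hε
  have hδ₀ : 0 < δ := ENNReal.ofReal_pos.1 hδε.1
  filter_upwards [Metric.tendstoUniformly_iff.1 (tendstoUniformly_jointCdf hμs hlim) (δ / 4)
    (by positivity)] with i hi
  refine lt_of_le_of_lt (iSup₂_le ?_) hδε.2
  rintro _ ⟨x₁, x₂, y₁, y₂, hx₁, hx, hx₂, hy₁, hy, hy₂, rfl⟩
  refine ENNReal.ofReal_le_ofReal ?_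
  have hclose {x y : ℝ} (hx : x ∈ Icc (0 : ℝ) 1) (hy : y ∈ Icc (0 : ℝ) 1) :
      |jointCdf μ x y - jointCdf (μs i) x y| < δ / 4 := hi (⟨x, hx⟩, ⟨y, hy⟩)
  have h₁ := abs_lt.1 (hclose ⟨hx₁, hx.trans hx₂⟩ ⟨hy₁, hy.trans hy₂⟩)
  have h₂ := abs_lt.1 (hclose ⟨hx₁, hx.trans hx₂⟩ ⟨hy₁.trans hy, hy₂⟩)
  have h₃ := abs_lt.1 (hclose ⟨hx₁.trans hx, hx₂⟩ ⟨hy₁, hy.trans hy₂⟩)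
  have h₄ := abs_lt.1 (hclose ⟨hx₁.trans hx, hx₂⟩ ⟨hy₁.trans hy, hy₂⟩)
  rw [(hμs i).real_Icc_prod_Icc hx hy, hμ.real_Icc_prod_Icc hx hy, abs_le]
  constructor <;> linarith

end IsPermuton

theorem strictMonoOn_uIcc_trans {α β : Type*} [LinearOrder α] [Preorder β] {f : α → β} {a b c : α}
    (hab : StrictMonoOn f (uIcc a b)) (hbc : StrictMonoOn f (uIcc b c)) :
    StrictMonoOn f (uIcc a c) := by
  intro x hx y hy hxy
  have hb : b ∈ uIcc a b := right_mem_uIcc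
  have hb' : b ∈ uIcc b c := left_mem_uIcc
  have hcases : (x ∈ uIcc a b ∧ y ∈ uIcc a b) ∨ (x ∈ uIcc b c ∧ y ∈ uIcc b c) ∨ (x < b ∧ b < y ∧
      (x ∈ uIcc a b ∧ y ∈ uIcc b c ∨ x ∈ uIcc b c ∧ y ∈ uIcc a b)) := by
    simp only [mem_uIcc] at *
    grind
  rcases hcases with ⟨hx, hy⟩ | ⟨hx, hy⟩ | ⟨hxb, hby, ⟨hx, hy⟩ | ⟨hx, hy⟩⟩
  · exact hab hx hy hxy
  · exact hbc hx hy hxy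
  · exact (hab hx hb hxb).trans (hbc hb' hy hby)
  · exact (hbc hx hb' hxb).trans (hab hb hy hby)

section Runs

variable {n : ℕ} (π : Equiv.Perm (Fin n))

theorem mem_run {i j : Fin n} : j ∈ run π i ↔ StrictMonoOn π (uIcc i j) := by
  simp only [run, Finset.mem_filter, Finset.mem_univ, true_and, StrictMonoOn, ← Finset.coe_uIcc,
    Finset.mem_coe]

theorem runMin_eq_of_mem_run {i j : Fin n} (h : j ∈ run π i) : runMin π i = runMin π j := by
  rw [mem_run] at h
  have hrun : run π i = run π j := by
    ext k
    simp only [mem_run]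
    exact ⟨strictMonoOn_uIcc_trans (by rwa [uIcc_comm]), strictMonoOn_uIcc_trans h⟩
  simp only [runMin, hrun]

theorem runMin_le (i : Fin n) : runMin π i ≤ π i :=
  Finset.inf'_le _ (self_mem_run π i)

theorem runMin_eq_of_descent {i j : Fin n} (hij : (j : ℕ) + 1 = i) (h : π i < π j) :
    runMin π i = π i := by
  refine (runMin_le π i).antisymm (Finset.le_inf' _ _ fun k hk => ?_)
  rw [mem_run] at hk
  have hik : i ≤ k := by
    by_contra! hki
    have hj : j ∈ uIcc i k := by
      simp only [mem_uIcc, Fin.le_def, Fin.lt_def] at hki ⊢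
      omega
    exact h.not_gt (hk hj left_mem_uIcc (Fin.lt_def.2 (by omega)))
  exact hk.monotoneOn left_mem_uIcc right_mem_uIcc hik

theorem runMin_eq_of_ascent {i j : Fin n} (hij : (j : ℕ) + 1 = i) (h : π j < π i) :
    runMin π i = runMin π j := by
  refine runMin_eq_of_mem_run π ((mem_run π).2 fun x hx y hy hxy => ?_)
  simp only [mem_uIcc, Fin.le_def, Fin.lt_def] at hx hy hxy
  obtain rfl : x = j := by ext; omega
  obtain rfl : y = i := by ext; omega
  exact h

/-- The number of positions whose entry is less than `b` and lies in a run with smallest entry less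
than `m`. -/
def lowRunCount (m b : ℕ) : ℕ :=
  (Finset.univ.filter fun i : Fin n => (runMin π i : ℕ) < m ∧ (π i : ℕ) < b).card

/-- The number of entries less than `b` among the first `a` entries of `runsort π`: the distribution
function of `gamma (runsort π)` at `(a / n, b / n)`, multiplied by `n`. -/
def runsortCount (a b : ℕ) : ℕ :=
  (Finset.univ.filter fun i : Fin n => (i : ℕ) < a ∧ (runsort π i : ℕ) < b).card

theorem card_filter_perm_lt (σ : Equiv.Perm (Fin n)) {b : ℕ} (hb : b ≤ n) :
    (Finset.univ.filter fun i : Fin n => (σ i : ℕ) < b).card = b := by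
  rw [Finset.card_equiv σ (t := Finset.univ.filter fun i : Fin n => (i : ℕ) < b) (by simp),
    Fin.card_filter_val_lt, min_eq_right hb]

theorem lowRunCount_of_le {m b : ℕ} (hbm : b ≤ m) (hbn : b ≤ n) : lowRunCount π m b = b := by
  refine Eq.trans (congrArg Finset.card (Finset.filter_congr fun i _ => ?_))
    (card_filter_perm_lt π hbn)
  have := Fin.le_def.1 (runMin_le π i)
  omega

theorem lt_lowRunCount_iff (m : ℕ) (i : Fin n) :
    (i : ℕ) < lowRunCount π m n ↔ (runMin π (Tuple.sort (runMin π) i) : ℕ) < m := by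
  have hmono : Monotone fun i => (runMin π (Tuple.sort (runMin π) i) : ℕ) :=
    Fin.val_strictMono.monotone.comp (Tuple.monotone_sort (runMin π))
  have hcard : (Finset.univ.filter fun i => (runMin π (Tuple.sort (runMin π) i) : ℕ) < m).card =
      lowRunCount π m n :=
    Finset.card_equiv (Tuple.sort (runMin π)) (by simp)
  rw [← hcard, Tuple.lt_card_lt_iff_apply_lt_of_monotone hmono]

theorem lowRunCount_eq_runsortCount (m b : ℕ) :
    lowRunCount π m b = runsortCount π (lowRunCount π m n) b := by
  refine (Finset.card_equiv (Tuple.sort (runMin π)) fun i => ?_).symm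
  simp only [Finset.mem_filter, Finset.mem_univ, true_and, lt_lowRunCount_iff, runsort,
    Equiv.Perm.mul_apply]

theorem card_filter_val_mem_Ico_le (a b : ℕ) :
    (Finset.univ.filter fun i : Fin n => (i : ℕ) ∈ Finset.Ico a b).card ≤ b - a := by
  rw [← Nat.card_Ico]
  exact Finset.card_le_card_of_injOn Fin.val (by simp [MapsTo]) Fin.val_injective.injOn

theorem runsortCount_le_add (a a' b : ℕ) :
    runsortCount π a' b ≤ runsortCount π a b + (a' - a) := by
  have hsub : (Finset.univ.filter fun i : Fin n => (i : ℕ) < a' ∧ (runsort π i : ℕ) < b) ⊆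
      (Finset.univ.filter fun i : Fin n => (i : ℕ) < a ∧ (runsort π i : ℕ) < b) ∪
        Finset.univ.filter fun i : Fin n => (i : ℕ) ∈ Finset.Ico a a' := by
    grind
  exact ((Finset.card_le_card hsub).trans (Finset.card_union_le _ _)).trans
    (Nat.add_le_add_left (card_filter_val_mem_Ico_le a a') _)

theorem abs_runsortCount_sub_le (a a' b : ℕ) :
    |(runsortCount π a b : ℝ) - runsortCount π a' b| ≤ |(a : ℝ) - a'| := by
  have h₁ := runsortCount_le_add π a a' b
  have h₂ := runsortCount_le_add π a' a b
  have h : |(runsortCount π a b : ℤ) - runsortCount π a' b| ≤ |(a : ℤ) - a'| := by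
    rcases le_total a a' with haa' | haa' <;> grind
  exact_mod_cast h

end Runs

theorem jointCdf_average {ι : Type*} [Fintype ι] (μs : ι → Measure (ℝ × ℝ))
    [∀ i, IsFiniteMeasure (μs i)] (x y : ℝ) :
    jointCdf ((Fintype.card ι : ℝ≥0∞)⁻¹ • ∑ i, μs i) x y = 𝔼 i, jointCdf (μs i) x y := by
  simp only [jointCdf, Measure.real, Measure.smul_apply, Measure.finsetSum_apply, smul_eq_mul,
    ENNReal.toReal_mul, ENNReal.toReal_sum fun i _ => measure_ne_top (μs i) _,
    ENNReal.toReal_inv, ENNReal.toReal_natCast, Fintype.expect_eq_sum_div_card, inv_mul_eq_div]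

section Gamma

/-- The `i`-th of the `n` intervals of length `1 / n` that make up `[0, 1)`. -/
def cell (n i : ℕ) : Set ℝ := Ico ((i : ℝ) / n) (((i : ℝ) + 1) / n)

theorem measurableSet_cell (n i : ℕ) : MeasurableSet (cell n i) := measurableSet_Ico

variable {n : ℕ} [NeZero n]

theorem mem_cell_iff {i : ℕ} {x : ℝ} : x ∈ cell n i ↔ 0 ≤ x ∧ ⌊x * n⌋₊ = i := by
  have hn : (0 : ℝ) < n := Nat.cast_pos.2 (NeZero.pos n)
  rw [cell, mem_Ico, div_le_iff₀ hn, lt_div_iff₀ hn]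
  constructor
  · rintro ⟨h₁, h₂⟩
    have h₀ : 0 ≤ x * n := (Nat.cast_nonneg i).trans h₁
    exact ⟨nonneg_of_mul_nonneg_left h₀ hn, (Nat.floor_eq_iff h₀).2 ⟨h₁, h₂⟩⟩
  · rintro ⟨h₀, h₁⟩
    exact (Nat.floor_eq_iff (by positivity)).1 h₁

theorem pairwise_disjoint_cell : Pairwise (Function.onFun Disjoint (cell n)) := by
  refine fun i j hij => Set.disjoint_left.2 fun x hi hj => hij ?_
  exact (mem_cell_iff.1 hi).2.symm.trans (mem_cell_iff.1 hj).2

theorem iUnion_cell : ⋃ i : Fin n, cell n i = Ico 0 1 := by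
  have hn : (0 : ℝ) < n := Nat.cast_pos.2 (NeZero.pos n)
  ext x
  simp only [mem_iUnion, mem_cell_iff, exists_and_left, mem_Ico]
  refine and_congr_right fun hx => ?_
  rw [← mul_lt_iff_lt_one_left hn, ← Nat.floor_lt (by positivity)]
  exact ⟨fun ⟨i, hi⟩ => hi ▸ i.2, fun h => ⟨⟨_, h⟩, rfl⟩⟩

theorem volume_cell (i : ℕ) : volume (cell n i) = (n : ℝ≥0∞)⁻¹ := by
  rw [cell, Real.volume_Ico, ← sub_div, add_sub_cancel_left, one_div,
    ENNReal.ofReal_inv_of_pos (Nat.cast_pos.2 (NeZero.pos n)), ENNReal.ofReal_natCast]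

theorem volume_Iic_inter_cell (a i : ℕ) :
    volume (Iic ((a : ℝ) / n) ∩ cell n i) = if i < a then (n : ℝ≥0∞)⁻¹ else 0 := by
  split_ifs with h
  · rw [inter_eq_self_of_subset_right, volume_cell]
    refine fun x hx => hx.2.le.trans ?_
    gcongr
    exact_mod_cast h
  · refine measure_mono_null (t := {(a : ℝ) / n}) (fun x hx => ?_) (by simp)
    refine hx.1.antisymm (le_trans ?_ hx.2.1)
    gcongr
    exact not_lt.1 h

theorem sum_restrict_cell :
    ∑ i : Fin n, (volume : Measure ℝ).restrict (cell n i) = volume.restrict (Icc 0 1) := by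
  rw [← restrict_Ico_eq_restrict_Icc, ← iUnion_cell (n := n), Measure.restrict_iUnion
    (pairwise_disjoint_cell.comp_of_injective Fin.val_injective)
    fun i => measurableSet_cell _ _, Measure.sum_fintype]

variable (π : Equiv.Perm (Fin n))

theorem gamma_eq_sum : gamma π = (n : ℝ≥0∞) •
    ∑ i : Fin n, (volume.restrict (cell n i)).prod (volume.restrict (cell n (π i))) := by
  have hmeas (i : Fin n) : MeasurableSet (cell n i ×ˢ cell n (π i)) :=
    (measurableSet_cell _ _).prod (measurableSet_cell _ _)
  have hdisj : Pairwise (Function.onFun Disjoint fun i : Fin n => cell n i ×ˢ cell n (π i)) :=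
    fun i j hij => Set.disjoint_prod.2 (.inl (pairwise_disjoint_cell (Fin.val_ne_of_ne hij)))
  have hgamma : gamma π = volume.withDensity
      ((⋃ i : Fin n, cell n i ×ˢ cell n (π i)).indicator fun _ => (n : ℝ≥0∞)) := rfl
  rw [hgamma, withDensity_indicator (MeasurableSet.iUnion hmeas), withDensity_const,
    Measure.restrict_iUnion hdisj hmeas, Measure.sum_fintype]
  simp only [Measure.prod_restrict, Measure.volume_eq_prod]

theorem isPermuton_gamma : IsPermuton (gamma π) := by
  have hcancel (μ : Measure ℝ) : (n : ℝ≥0∞) • (n : ℝ≥0∞)⁻¹ • μ = μ := by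
    rw [smul_smul, ENNReal.mul_inv_cancel (NeZero.ne _) (ENNReal.natCast_ne_top n), one_smul]
  refine ⟨⟨measurable_fst, ?_⟩, ⟨measurable_snd, ?_⟩⟩
  · simp only [gamma_eq_sum, Measure.map_smul, Measure.map_finset_sum measurable_fst.aemeasurable,
      Measure.map_fst_prod, Measure.restrict_apply_univ, volume_cell, ← Finset.smul_sum, hcancel,
      sum_restrict_cell]
  · simp only [gamma_eq_sum, Measure.map_smul, Measure.map_finset_sum measurable_snd.aemeasurable,
      Measure.map_snd_prod, Measure.restrict_apply_univ, volume_cell, ← Finset.smul_sum, hcancel]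
    rw [Equiv.sum_comp π fun i : Fin n => (volume : Measure ℝ).restrict (cell n i),
      sum_restrict_cell]

theorem jointCdf_gamma (a b : ℕ) :
    jointCdf (gamma π) (a / n) (b / n) =
      ((Finset.univ.filter fun i : Fin n => (i : ℕ) < a ∧ (π i : ℕ) < b).card : ℝ) / n := by
  have hn : (n : ℝ) ≠ 0 := NeZero.ne _
  have hterm (i : Fin n) :
      (if (i : ℕ) < a then (n : ℝ≥0∞)⁻¹ else 0) * (if (π i : ℕ) < b then (n : ℝ≥0∞)⁻¹ else 0) =
      if (i : ℕ) < a ∧ (π i : ℕ) < b then (n : ℝ≥0∞)⁻¹ * (n : ℝ≥0∞)⁻¹ else 0 := by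
    split_ifs <;> simp_all
  simp only [jointCdf, Measure.real, gamma_eq_sum, Measure.smul_apply, Measure.finsetSum_apply,
    Measure.prod_prod, Measure.restrict_apply measurableSet_Iic, volume_Iic_inter_cell, hterm,
    ← Finset.sum_filter, Finset.sum_const, smul_eq_mul, nsmul_eq_mul, ENNReal.toReal_mul,
    ENNReal.toReal_natCast, ENNReal.toReal_inv]
  field_simp

end Gamma

section MeanMeasure

variable (n : ℕ)

theorem meanMeasure_eq_average :
    meanMeasure n = (Fintype.card (Equiv.Perm (Fin n)) : ℝ≥0∞)⁻¹ •
      ∑ π : Equiv.Perm (Fin n), gamma (runsort π) := by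
  rw [meanMeasure, Fintype.card_perm, Fintype.card_fin]

variable [NeZero n]

theorem isPermuton_meanMeasure : IsPermuton (meanMeasure n) := by
  rw [meanMeasure_eq_average]
  exact IsPermuton.average fun π => isPermuton_gamma (runsort π)

theorem jointCdf_meanMeasure (a b : ℕ) :
    jointCdf (meanMeasure n) (a / n) (b / n) =
      𝔼 π : Equiv.Perm (Fin n), (runsortCount π a b : ℝ) / n := by
  have (π : Equiv.Perm (Fin n)) := (isPermuton_gamma (runsort π)).isProbabilityMeasure
  rw [meanMeasure_eq_average, jointCdf_average]
  simp only [jointCdf_gamma, runsortCount]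

end MeanMeasure

theorem p_eq_expect (n : ℕ) (i j : Fin n) :
    p n i j = 𝔼 π : Equiv.Perm (Fin n), if runsort π i = j then (1 : ℝ) else 0 := by
  simp only [p, Fintype.expect_eq_sum_div_card, Finset.sum_boole, Fintype.card_perm,
    Fintype.card_fin]

theorem mul_lt_and_le_mul_iff {n i : ℕ} {s t : ℝ} (hs : 0 ≤ s) (ht : 0 ≤ t) :
    (s * n < (i : ℝ) + 1 ∧ (i : ℝ) + 1 ≤ t * n) ↔ ⌊s * n⌋₊ ≤ i ∧ i < ⌊t * n⌋₊ := by
  rw [← Nat.lt_succ_iff, Nat.floor_lt (by positivity), ← Nat.succ_le_iff (m := i),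
    Nat.le_floor_iff (by positivity)]
  push_cast
  rfl

theorem sum_ite_runsort {n : ℕ} (π : Equiv.Perm (Fin n)) {a a' b b' : ℕ} (ha : a ≤ a')
    (hb : b ≤ b') :
    (∑ i : Fin n, if (a ≤ (i : ℕ) ∧ (i : ℕ) < a') ∧ (b ≤ (runsort π i : ℕ) ∧
      (runsort π i : ℕ) < b') then (1 : ℝ) else 0) =
      runsortCount π a' b' - runsortCount π a b' - runsortCount π a' b + runsortCount π a b := by
  simp only [runsortCount, Finset.card_filter, Nat.cast_sum, Nat.cast_ite, Nat.cast_one,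
    Nat.cast_zero, ← Finset.sum_sub_distrib, ← Finset.sum_add_distrib]
  refine Finset.sum_congr rfl fun i _ => ?_
  grind

theorem E_eq (n : ℕ) {x₁ x₂ y₁ y₂ : ℝ} (hx₁ : 0 ≤ x₁) (hx : x₁ ≤ x₂) (hy₁ : 0 ≤ y₁)
    (hy : y₁ ≤ y₂) :
    E n x₁ x₂ y₁ y₂ =
      (𝔼 π : Equiv.Perm (Fin n), (runsortCount π ⌊x₂ * n⌋₊ ⌊y₂ * n⌋₊ : ℝ) / n) -
      (𝔼 π : Equiv.Perm (Fin n), (runsortCount π ⌊x₁ * n⌋₊ ⌊y₂ * n⌋₊ : ℝ) / n) -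
      (𝔼 π : Equiv.Perm (Fin n), (runsortCount π ⌊x₂ * n⌋₊ ⌊y₁ * n⌋₊ : ℝ) / n) +
      (𝔼 π : Equiv.Perm (Fin n), (runsortCount π ⌊x₁ * n⌋₊ ⌊y₁ * n⌋₊ : ℝ) / n) := by
  have hite (P : Prop) [Decidable P] (i j : Fin n) : (if P then p n i j else 0) =
      𝔼 π : Equiv.Perm (Fin n), if runsort π i = j then (if P then (1 : ℝ) else 0) else 0 := by
    rw [p_eq_expect]
    split_ifs <;> simp
  simp only [E, mul_lt_and_le_mul_iff hx₁ (hx₁.trans hx), mul_lt_and_le_mul_iff hy₁ (hy₁.trans hy),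
    hite, ← Finset.expect_sum_comm, Finset.sum_ite_eq, Finset.mem_univ, if_true,
    sum_ite_runsort _ (Nat.floor_mono (by gcongr : x₁ * n ≤ x₂ * n))
    (Nat.floor_mono (by gcongr : y₁ * n ≤ y₂ * n)), Finset.mul_expect,
    ← Finset.expect_sub_distrib, ← Finset.expect_add_distrib]
  refine Finset.expect_congr rfl fun π _ => ?_
  ring

section Sampling

theorem abs_expect_comp_sub_expect_le {β γ : Type*} [Fintype β] [Fintype γ] [Nonempty β]
    {g : β → γ} (hg : Function.Injective g) {f : γ → ℝ} (hf : ∀ c, f c ∈ Icc (0 : ℝ) 1) :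
    |(𝔼 b, f (g b)) - 𝔼 c, f c| ≤ 1 - (Fintype.card β : ℝ) / Fintype.card γ := by
  have hle (f : γ → ℝ) (hf : ∀ c, 0 ≤ f c) : ∑ b, f (g b) ≤ ∑ c, f c :=
    (Finset.sum_map Finset.univ ⟨g, hg⟩ f).symm.trans_le
      (Finset.sum_le_univ_sum_of_nonneg hf)
  have hle_sum := hle f fun c => (hf c).1
  have hle_compl := hle (fun c => 1 - f c) fun c => sub_nonneg.2 (hf c).2
  have hnonneg : 0 ≤ ∑ b, f (g b) := Finset.sum_nonneg fun b _ => (hf (g b)).1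
  have hle_card : ∑ b, f (g b) ≤ Fintype.card β := by
    simpa using Finset.sum_le_sum fun b (_ : b ∈ Finset.univ) => (hf (g b)).2
  have hβ : (0 : ℝ) < Fintype.card β := Nat.cast_pos.2 Fintype.card_pos
  have hβγ : (Fintype.card β : ℝ) ≤ Fintype.card γ :=
    Nat.cast_le.2 (Fintype.card_le_of_injective g hg)
  simp only [Finset.sum_sub_distrib, Finset.sum_const, Finset.card_univ, nsmul_eq_mul,
    mul_one] at hle_compl
  rw [Fintype.expect_eq_sum_div_card, Fintype.expect_eq_sum_div_card]
  generalize ∑ b, f (g b) = S at *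
  generalize ∑ c, f c = T at *
  generalize (Fintype.card β : ℝ) = B at *
  generalize (Fintype.card γ : ℝ) = C at *
  have hC : 0 < C := hβ.trans_le hβγ
  rw [abs_le]
  constructor
  · have hdiv : S / C ≤ S / B := by gcongr
    have hT : T / C ≤ (S + C - B) / C := by gcongr; linarith
    have hsplit : (S + C - B) / C = S / C + 1 - B / C := by field_simp
    linarith
  · have hdiv : S / C ≤ T / C := by gcongr
    have hdiff : S / B - S / C ≤ 1 - B / C := by
      have hfactor : S / B - S / C = S / B * (1 - B / C) := by field_simp
      rw [hfactor]
      exact mul_le_of_le_one_left (sub_nonneg.2 ((div_le_one hC).2 hβγ))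
        ((div_le_one hβ).2 hle_card)
    linarith

theorem exists_perm_comp_eq {ι α : Type*} [Finite α] (v w : ι ↪ α) :
    ∃ τ : Equiv.Perm α, τ ∘ v = w := by
  classical
  let e : range v ≃ range w :=
    (Equiv.ofInjective v v.injective).symm.trans (Equiv.ofInjective w w.injective)
  refine ⟨e.extendSubtype, funext fun i => ?_⟩
  have hsymm : (Equiv.ofInjective v v.injective).symm ⟨v i, i, rfl⟩ = i :=
    Equiv.ofInjective_symm_apply v.injective i
  rw [Function.comp_apply, e.extendSubtype_apply_of_mem (v i) ⟨i, rfl⟩]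
  simp [e, hsymm]

theorem expect_mul_comp_inl_inr {ι κ α : Type*} [Fintype ι] [Fintype κ] [Fintype α]
    [DecidableEq ι] [DecidableEq κ] (φ : (ι → α) → ℝ) (ψ : (κ → α) → ℝ) :
    𝔼 w : ι ⊕ κ → α, φ (w ∘ Sum.inl) * ψ (w ∘ Sum.inr) = (𝔼 w, φ w) * 𝔼 w, ψ w := by
  rw [Finset.expect_mul_expect, ← Finset.expect_product', Finset.univ_product_univ]
  exact Fintype.expect_equiv (Equiv.sumArrowEquivProdArrow _ _ α) _ _ fun _ => rfl

variable {ι α : Type*} [Fintype ι] [Fintype α] [DecidableEq α]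

theorem expect_perm_comp_eq_expect_embedding (e : ι ↪ α) (φ : (ι → α) → ℝ) :
    𝔼 π : Equiv.Perm α, φ (π ∘ e) = 𝔼 v : ι ↪ α, φ v := by
  classical
  have : Nonempty (ι ↪ α) := ⟨e⟩
  have hinv (v : ι ↪ α) : 𝔼 π : Equiv.Perm α, φ (π ∘ v) = 𝔼 π : Equiv.Perm α, φ (π ∘ e) := by
    obtain ⟨τ, hτ⟩ := exists_perm_comp_eq e v
    exact Fintype.expect_equiv (Equiv.mulRight τ) _ _ fun π => by rw [← hτ]; rfl
  calc 𝔼 π : Equiv.Perm α, φ (π ∘ e)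
    _ = 𝔼 v : ι ↪ α, 𝔼 π : Equiv.Perm α, φ (π ∘ v) := by simp only [hinv, Fintype.expect_const]
    _ = 𝔼 π : Equiv.Perm α, 𝔼 v : ι ↪ α, φ (π ∘ v) := Finset.expect_comm _ _ _
    _ = 𝔼 _π : Equiv.Perm α, 𝔼 v : ι ↪ α, φ v := Finset.expect_congr rfl fun π _ =>
      Fintype.expect_equiv ((Equiv.refl ι).embeddingCongr π) _ _ fun v => rfl
    _ = 𝔼 v : ι ↪ α, φ v := Fintype.expect_const _

/-- The probability that `s` independent uniform elements of a set of size `n` are not pairwise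
distinct. -/
noncomputable def collisionProb (s n : ℕ) : ℝ := 1 - n.descFactorial s / n ^ s

theorem collisionProb_nonneg (s n : ℕ) : 0 ≤ collisionProb s n :=
  sub_nonneg.2 <| div_le_one_of_le₀ (mod_cast Nat.descFactorial_le_pow n s) (by positivity)

theorem tendsto_collisionProb (s : ℕ) : Tendsto (collisionProb s) atTop (𝓝 0) := by
  have hpow : ∀ᶠ n : ℕ in atTop, (n : ℝ) ^ s ≠ 0 := by
    filter_upwards [eventually_ne_atTop 0] with n hn
    exact pow_ne_zero s (Nat.cast_ne_zero.2 hn)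
  have h := (Asymptotics.isEquivalent_iff_tendsto_one hpow).1 (isEquivalent_descFactorial s)
  simpa only [sub_self] using! h.const_sub 1

theorem abs_expect_perm_sub_expect_le [DecidableEq ι] (e : ι ↪ α) {φ : (ι → α) → ℝ}
    (hφ : ∀ w, φ w ∈ Icc (0 : ℝ) 1) :
    |(𝔼 π : Equiv.Perm α, φ (π ∘ e)) - 𝔼 w, φ w| ≤
      collisionProb (Fintype.card ι) (Fintype.card α) := by
  have : Nonempty (ι ↪ α) := ⟨e⟩
  rw [expect_perm_comp_eq_expect_embedding]
  refine (abs_expect_comp_sub_expect_le DFunLike.coe_injective hφ).trans_eq ?_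
  rw [collisionProb, Fintype.card_embedding_eq, Fintype.card_fun, Nat.cast_pow]

end Sampling

section Chains

variable {n : ℕ}

theorem runMin_lt_iff (π : Equiv.Perm (Fin n)) {i j : Fin n} (hij : (j : ℕ) + 1 = i) (m : ℕ) :
    (runMin π i : ℕ) < m ↔ (π i : ℕ) < m ∨ (runMin π j : ℕ) < m ∧ π j < π i := by
  have hi := Fin.le_def.1 (runMin_le π i)
  have hne : π j ≠ π i := π.injective.ne fun h => by omega
  rcases hne.lt_or_gt with h | h
  · rw [runMin_eq_of_ascent π hij h] at hi ⊢
    grind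
  · rw [runMin_eq_of_descent π hij h]
    grind

/-- Started at `v`, the word `w` is read as long as it decreases and no letter is less than `m`:
the value is `1` if a letter less than `m` is met (`v` included), `0` if an ascent occurs first, and
`c` if the end of the word is reached. -/
def chainIndicator (m : ℕ) (c : ℝ) : (K v : ℕ) → (Fin K → Fin n) → ℝ
  | 0, v, _ => if v < m then 1 else c
  | K + 1, v, w =>
    if v < m then 1 else if w 0 < v then chainIndicator m c K (w 0) (Fin.tail w) else 0

theorem chainIndicator_mem_Icc (m : ℕ) {c : ℝ} (hc : c ∈ Icc (0 : ℝ) 1) (K v : ℕ)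
    (w : Fin K → Fin n) : chainIndicator m c K v w ∈ Icc (0 : ℝ) 1 := by
  induction K generalizing v with
  | zero => unfold chainIndicator; grind
  | succ K ih => unfold chainIndicator; grind

theorem chainIndicator_of_lt {m v : ℕ} (h : v < m) (c : ℝ) (K : ℕ) (w : Fin K → Fin n) :
    chainIndicator m c K v w = 1 := by
  cases K <;> exact if_pos h

/-- The positions `i, i - 1, …, i - K + 1`; the subtraction truncates at `0`, so that this is a
window of `K` positions only for `K ≤ i + 1`. -/
def window (K : ℕ) (i : Fin n) (j : Fin K) : Fin n := ⟨i - j, by omega⟩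

theorem window_injective {K : ℕ} {i : Fin n} (hi : K ≤ i) : Function.Injective (window K i) := by
  intro j j' h
  simp only [window, Fin.mk.injEq] at h
  omega

/-- The indicator function of the positions counted by `lowRunCount π m b`. -/
def lowRunIndicator (π : Equiv.Perm (Fin n)) (m b : ℕ) (i : Fin n) : ℝ :=
  if (runMin π i : ℕ) < m ∧ (π i : ℕ) < b then 1 else 0

theorem lowRunIndicator_mem_Icc_chainIndicator (π : Equiv.Perm (Fin n)) {m b K : ℕ} (hmb : m ≤ b)
    {i : Fin n} (hi : K ≤ i) :
    lowRunIndicator π m b i ∈ Icc (chainIndicator m 0 K b (π ∘ window K i))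
      (chainIndicator m 1 K b (π ∘ window K i)) := by
  induction K generalizing i b with
  | zero => simp only [chainIndicator, lowRunIndicator]; grind
  | succ K ih =>
    obtain ⟨j, hij⟩ : ∃ j : Fin n, (j : ℕ) + 1 = i := ⟨⟨i - 1, by omega⟩, by simp; omega⟩
    have hhead : (π ∘ window (K + 1) i) 0 = π i := rfl
    have htail : Fin.tail (π ∘ window (K + 1) i) = π ∘ window K j := by
      ext k
      have hk : (i : ℕ) - (k + 1) = j - k := by omega
      simp only [Fin.tail, window, Function.comp_apply, Fin.val_succ, hk]
    have hiff := runMin_lt_iff π hij m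
    simp only [chainIndicator, hhead, htail, if_neg hmb.not_gt]
    rcases lt_or_ge (π i : ℕ) b with hb | hb
    · rcases lt_or_ge (π i : ℕ) m with hm | hm
      · simp [chainIndicator_of_lt, lowRunIndicator, hiff, hb, hm]
      · have hrec : lowRunIndicator π m b i = lowRunIndicator π m (π i) j := by
          simp [lowRunIndicator, hiff, hb, hm.not_gt]
        simpa only [hrec, if_pos hb] using ih hm (by omega)
    · simp [lowRunIndicator, hb.not_gt]

theorem expect_word_succ (K : ℕ) (φ : (Fin (K + 1) → Fin n) → ℝ) :
    𝔼 w, φ w = 𝔼 v : Fin n, 𝔼 w : Fin K → Fin n, φ (Fin.cons v w) := by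
  rw [← Finset.expect_product', Finset.univ_product_univ]
  exact (Fintype.expect_equiv (Fin.consEquiv fun _ : Fin (K + 1) => Fin n) _ _ fun _ => rfl).symm

theorem expect_chainIndicator_succ [NeZero n] (m : ℕ) (c : ℝ) (K v : ℕ) :
    𝔼 w : Fin (K + 1) → Fin n, chainIndicator m c (K + 1) v w =
      if v < m then 1
      else 𝔼 u : Fin n, if u < v then 𝔼 w : Fin K → Fin n, chainIndicator m c K u w else 0 := by
  simp only [chainIndicator]
  split_ifs
  · exact Fintype.expect_const 1
  · rw [expect_word_succ]
    refine Finset.expect_congr rfl fun u _ => ?_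
    simp only [Fin.cons_zero, Fin.tail_cons]
    split_ifs
    · rfl
    · exact Fintype.expect_const 0

theorem expect_ite_lt {v : ℕ} (hv : v ≤ n) (F : ℕ → ℝ) :
    (𝔼 u : Fin n, if (u : ℕ) < v then F u else 0) = (∑ u ∈ Finset.range v, F u) / n := by
  rw [Fintype.expect_eq_sum_div_card, Fintype.card_fin,
    Fin.sum_univ_eq_sum_range (fun u => if u < v then F u else 0), ← Finset.sum_filter]
  congr 2
  ext u
  simp only [Finset.mem_filter, Finset.mem_range]
  omega

/-- The limit for `K → ∞` of the expectation of `chainIndicator m c K v` over the words in the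
alphabet `Fin n`: the probability that a sequence of independent uniform letters, started at `v`,
decreases until it meets a letter less than `m`. -/
noncomputable def chainProb (n m v : ℕ) : ℝ :=
  if v < m then 1 else (m : ℝ) / n * (1 + 1 / n) ^ (v - m)

theorem chainProb_eq_sum [NeZero n] {m v : ℕ} (h : m ≤ v) :
    chainProb n m v = (∑ u ∈ Finset.range v, chainProb n m u) / n := by
  induction v, h using Nat.le_induction with
  | base =>
    have hone : ∀ u ∈ Finset.range m, chainProb n m u = 1 := fun u hu =>
      if_pos (Finset.mem_range.1 hu)
    rw [Finset.sum_congr rfl hone]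
    simp [chainProb]
  | succ v hv ih =>
    rw [Finset.sum_range_succ, add_div, ← ih, chainProb, chainProb, if_neg (by omega),
      if_neg (by omega), Nat.succ_sub hv, pow_succ]
    ring

theorem chainProb_mem_Icc [NeZero n] (m : ℕ) {v : ℕ} (hv : v ≤ n) :
    chainProb n m v ∈ Icc (0 : ℝ) 1 := by
  refine ⟨by unfold chainProb; positivity, ?_⟩
  induction v using Nat.strong_induction_on with
  | _ v ih =>
    rcases lt_or_ge v m with h | h
    · rw [chainProb, if_pos h]
    · have hsum : ∑ u ∈ Finset.range v, chainProb n m u ≤ v := by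
        simpa using Finset.sum_le_card_nsmul _ _ 1 fun u hu =>
          ih u (Finset.mem_range.1 hu) ((Finset.mem_range.1 hu).le.trans hv)
      rw [chainProb_eq_sum h]
      exact div_le_one_of_le₀ (hsum.trans (Nat.cast_le.2 hv)) n.cast_nonneg

theorem sum_range_choose_left (v K : ℕ) :
    ∑ u ∈ Finset.range v, u.choose K = v.choose (K + 1) := by
  induction v with
  | zero => rfl
  | succ v ih => rw [Finset.sum_range_succ, ih, Nat.choose_succ_succ, add_comm]

theorem abs_expect_chainIndicator_sub_le_choose [NeZero n] (m : ℕ) {c : ℝ}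
    (hc : c ∈ Icc (0 : ℝ) 1) (K : ℕ) {v : ℕ} (hv : v ≤ n) :
    |(𝔼 w : Fin K → Fin n, chainIndicator m c K v w) - chainProb n m v| ≤
      (v.choose K : ℝ) / n ^ K := by
  induction K generalizing v with
  | zero =>
    have h₁ := chainProb_mem_Icc m hv
    have h₂ := chainIndicator_mem_Icc m hc 0 v (default : Fin 0 → Fin n)
    simp only [chainIndicator, Fintype.expect_const, Nat.choose_zero_right, Nat.cast_one, pow_zero,
      div_one] at h₂ ⊢
    exact abs_sub_le_of_nonneg_of_le h₂.1 h₂.2 h₁.1 h₁.2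
  | succ K ih =>
    rw [expect_chainIndicator_succ]
    rcases lt_or_ge v m with h | h
    · rw [if_pos h, chainProb, if_pos h, sub_self, abs_zero]
      positivity
    · rw [if_neg (not_lt.2 h), chainProb_eq_sum h,
        expect_ite_lt hv fun u => 𝔼 w : Fin K → Fin n, chainIndicator m c K u w, ← sub_div,
        ← Finset.sum_sub_distrib, abs_div, Nat.abs_cast, pow_succ, ← div_div]
      gcongr
      calc |∑ u ∈ Finset.range v, ((𝔼 w : Fin K → Fin n, chainIndicator m c K u w) -
              chainProb n m u)|
        _ ≤ ∑ u ∈ Finset.range v, (u.choose K : ℝ) / n ^ K :=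
          (Finset.abs_sum_le_sum_abs _ _).trans <| Finset.sum_le_sum fun u hu =>
            ih ((Finset.mem_range.1 hu).le.trans hv)
        _ = (v.choose (K + 1) : ℝ) / n ^ K := by
          rw [← Finset.sum_div, ← Nat.cast_sum, sum_range_choose_left]

theorem abs_expect_chainIndicator_sub_le [NeZero n] (m : ℕ) {c : ℝ} (hc : c ∈ Icc (0 : ℝ) 1)
    (K : ℕ) {v : ℕ} (hv : v ≤ n) :
    |(𝔼 w : Fin K → Fin n, chainIndicator m c K v w) - chainProb n m v| ≤ 1 / K.factorial := by
  have hn : (0 : ℝ) < n := Nat.cast_pos.2 (NeZero.pos n)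
  calc _ ≤ (v.choose K : ℝ) / n ^ K := abs_expect_chainIndicator_sub_le_choose m hc K hv
    _ ≤ (n ^ K / K.factorial) / n ^ K := by
      gcongr
      exact (Nat.choose_le_pow_div K v).trans (by gcongr)
    _ = 1 / K.factorial := by field_simp

end Chains

section Concentration

variable {n : ℕ}

theorem lowRunIndicator_mem_Icc (π : Equiv.Perm (Fin n)) (m b : ℕ) (i : Fin n) :
    lowRunIndicator π m b i ∈ Icc (0 : ℝ) 1 := by
  unfold lowRunIndicator
  split_ifs <;> simp

theorem lowRunCount_div_eq_expect (π : Equiv.Perm (Fin n)) (m b : ℕ) :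
    (lowRunCount π m b : ℝ) / n = 𝔼 i, lowRunIndicator π m b i := by
  simp [Fintype.expect_eq_sum_div_card, lowRunCount, lowRunIndicator]

theorem le_expect_lowRunIndicator {m b : ℕ} (hmb : m ≤ b) (hbn : b ≤ n) {K : ℕ} {i : Fin n}
    (hi : K ≤ i) :
    chainProb n m b - (1 / K.factorial + collisionProb K n) ≤
      𝔼 π : Equiv.Perm (Fin n), lowRunIndicator π m b i := by
  have : NeZero n := ⟨(Fin.pos i).ne'⟩
  have hsample := abs_expect_perm_sub_expect_le ⟨window K i, window_injective hi⟩
    (chainIndicator_mem_Icc m (left_mem_Icc.2 zero_le_one) K b)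
  have hchain := abs_expect_chainIndicator_sub_le m (left_mem_Icc.2 zero_le_one) K hbn
  have hindicator : 𝔼 π : Equiv.Perm (Fin n), chainIndicator m 0 K b (π ∘ window K i) ≤
      𝔼 π : Equiv.Perm (Fin n), lowRunIndicator π m b i :=
    Finset.expect_le_expect fun π _ => (lowRunIndicator_mem_Icc_chainIndicator π hmb hi).1
  rw [Fintype.card_fin, Fintype.card_fin] at hsample
  rw [abs_le] at hsample hchain
  linarith! [hsample.1, hchain.1]

theorem expect_lowRunIndicator_mul_le {m b : ℕ} (hmb : m ≤ b) (hbn : b ≤ n) {K : ℕ} {i j : Fin n}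
    (hi : K ≤ i) (hj : K ≤ j) (hij : (i : ℕ) + K ≤ j ∨ (j : ℕ) + K ≤ i) :
    𝔼 π : Equiv.Perm (Fin n), lowRunIndicator π m b i * lowRunIndicator π m b j ≤
      chainProb n m b ^ 2 + 2 / K.factorial + collisionProb (K + K) n := by
  have : NeZero n := ⟨(Fin.pos i).ne'⟩
  let e : Fin K ⊕ Fin K ↪ Fin n := ⟨Sum.elim (window K i) (window K j),
    (window_injective hi).sumElim (window_injective hj) fun a a' h => by
      simp only [window, Fin.mk.injEq] at h
      omega⟩
  let U : (Fin K → Fin n) → ℝ := chainIndicator m 1 K b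
  have hU := chainIndicator_mem_Icc (n := n) m (right_mem_Icc.2 zero_le_one) K b
  have hsample := abs_expect_perm_sub_expect_le e (φ := fun w => U (w ∘ Sum.inl) * U (w ∘ Sum.inr))
    fun w => ⟨mul_nonneg (hU _).1 (hU _).1, mul_le_one₀ (hU _).2 (hU _).1 (hU _).2⟩
  have hchain : (𝔼 w, U w) - chainProb n m b ≤ 1 / K.factorial :=
    (le_abs_self _).trans (abs_expect_chainIndicator_sub_le m (right_mem_Icc.2 zero_le_one) K hbn)
  have hindicator : 𝔼 π : Equiv.Perm (Fin n), lowRunIndicator π m b i * lowRunIndicator π m b j ≤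
      𝔼 π : Equiv.Perm (Fin n), U (π ∘ window K i) * U (π ∘ window K j) :=
    Finset.expect_le_expect fun π _ => mul_le_mul
      (lowRunIndicator_mem_Icc_chainIndicator π hmb hi).2
      (lowRunIndicator_mem_Icc_chainIndicator π hmb hj).2 (lowRunIndicator_mem_Icc π m b j).1
      (hU _).1
  have hsq : (𝔼 w, U w) ^ 2 ≤ chainProb n m b ^ 2 + 2 / K.factorial := by
    have hmean₀ : 0 ≤ 𝔼 w, U w := Finset.expect_nonneg fun w _ => (hU w).1
    have hmean₁ : 𝔼 w, U w ≤ 1 := Finset.expect_le Finset.univ_nonempty fun w _ => (hU w).2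
    have hprob := chainProb_mem_Icc m hbn
    have hε : (0 : ℝ) ≤ 1 / K.factorial := by positivity
    have hε' : (2 : ℝ) / K.factorial = 2 * (1 / K.factorial) := by ring
    nlinarith [hprob.1, hprob.2]
  rw [expect_mul_comp_inl_inr, ← sq, Fintype.card_sum, Fintype.card_fin,
    Fintype.card_fin] at hsample
  linarith! [(le_abs_self _).trans hsample]

theorem expect_lowRunIndicator_sub_mul_sub_le {m b : ℕ} (hmb : m ≤ b) (hbn : b ≤ n) {K : ℕ}
    {i j : Fin n} (hi : K ≤ i) (hj : K ≤ j) (hij : (i : ℕ) + K ≤ j ∨ (j : ℕ) + K ≤ i) :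
    𝔼 π : Equiv.Perm (Fin n), (lowRunIndicator π m b i - chainProb n m b) *
        (lowRunIndicator π m b j - chainProb n m b) ≤
      4 / K.factorial + 2 * collisionProb K n + collisionProb (K + K) n := by
  have : NeZero n := ⟨(Fin.pos i).ne'⟩
  have hprod := expect_lowRunIndicator_mul_le hmb hbn hi hj hij
  have hi' := le_expect_lowRunIndicator hmb hbn hi
  have hj' := le_expect_lowRunIndicator hmb hbn hj
  have hprob := chainProb_mem_Icc m hbn
  have hexpand : 𝔼 π : Equiv.Perm (Fin n), (lowRunIndicator π m b i - chainProb n m b) *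
        (lowRunIndicator π m b j - chainProb n m b) =
      (𝔼 π : Equiv.Perm (Fin n), lowRunIndicator π m b i * lowRunIndicator π m b j) -
        chainProb n m b * ((𝔼 π : Equiv.Perm (Fin n), lowRunIndicator π m b i) +
          𝔼 π : Equiv.Perm (Fin n), lowRunIndicator π m b j) + chainProb n m b ^ 2 := by
    simp only [sub_mul, mul_sub, Finset.expect_sub_distrib, ← Finset.expect_mul,
      ← Finset.mul_expect, Fintype.expect_const]
    ring
  rw [hexpand]
  have hlow := mul_le_mul_of_nonneg_left (add_le_add hi' hj') hprob.1
  have herr : chainProb n m b * (1 / K.factorial + collisionProb K n) ≤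
      1 / K.factorial + collisionProb K n :=
    mul_le_of_le_one_left (add_nonneg (by positivity) (collisionProb_nonneg K n)) hprob.2
  have hfour : (4 : ℝ) / K.factorial = 2 / K.factorial + 2 * (1 / K.factorial) := by ring
  linarith

theorem expect_expect_le_add [NeZero n] {K : ℕ} {C : ℝ} (hC : 0 ≤ C) {c : Fin n → Fin n → ℝ}
    (hone : ∀ i j, c i j ≤ 1)
    (hfar : ∀ i j : Fin n, K ≤ i → K ≤ j → (i : ℕ) + K ≤ j ∨ (j : ℕ) + K ≤ i → c i j ≤ C) :
    𝔼 i, 𝔼 j, c i j ≤ C + 4 * K / n := by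
  let χ (a b : ℕ) (i : Fin n) : ℝ := if (i : ℕ) ∈ Finset.Ico a b then 1 else 0
  have hχ (a b : ℕ) : 𝔼 i, χ a b i ≤ ((b - a : ℕ) : ℝ) / n := by
    rw [Fintype.expect_eq_sum_div_card, Finset.sum_boole, Fintype.card_fin]
    gcongr
    exact card_filter_val_mem_Ico_le a b
  have hpair (i j : Fin n) : c i j ≤ C + χ 0 K i + χ 0 K j + χ (i - K) (i + K) j := by
    have h₁ := hone i j
    have h₂ := hfar i j
    simp only [χ, Finset.mem_Ico, zero_le, true_and]
    grind
  calc 𝔼 i, 𝔼 j, c i j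
    _ ≤ 𝔼 i, 𝔼 j, (C + χ 0 K i + χ 0 K j + χ (i - K) (i + K) j) :=
      Finset.expect_le_expect fun i _ => Finset.expect_le_expect fun j _ => hpair i j
    _ ≤ 𝔼 i, (C + χ 0 K i + K / n + 2 * K / n) := by
      refine Finset.expect_le_expect fun i _ => ?_
      have hwidth : (((i : ℕ) + K - (i - K) : ℕ) : ℝ) / n ≤ 2 * K / n := by
        gcongr
        exact_mod_cast (by omega : (i : ℕ) + K - (i - K) ≤ 2 * K)
      simp only [Finset.expect_add_distrib, Fintype.expect_const]
      gcongr
      · exact hχ 0 K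
      · exact (hχ _ _).trans hwidth
    _ ≤ C + K / n + K / n + 2 * K / n := by
      simp only [Finset.expect_add_distrib, Fintype.expect_const]
      gcongr
      exact hχ 0 K
    _ = C + 4 * K / n := by ring

theorem expect_sq_lowRunCount_sub_le [NeZero n] {m b : ℕ} (hmb : m ≤ b) (hbn : b ≤ n) (K : ℕ) :
    𝔼 π : Equiv.Perm (Fin n), ((lowRunCount π m b : ℝ) / n - chainProb n m b) ^ 2 ≤
      4 / K.factorial + 2 * collisionProb K n + collisionProb (K + K) n + 4 * K / n := by
  let X (π : Equiv.Perm (Fin n)) (i : Fin n) : ℝ := lowRunIndicator π m b i - chainProb n m b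
  have hX (π : Equiv.Perm (Fin n)) (i : Fin n) : |X π i| ≤ 1 :=
    abs_sub_le_of_nonneg_of_le (lowRunIndicator_mem_Icc π m b i).1
      (lowRunIndicator_mem_Icc π m b i).2 (chainProb_mem_Icc m hbn).1 (chainProb_mem_Icc m hbn).2
  have hsq (π : Equiv.Perm (Fin n)) :
      ((lowRunCount π m b : ℝ) / n - chainProb n m b) ^ 2 = 𝔼 i, 𝔼 j, X π i * X π j := by
    rw [← Finset.expect_mul_expect, ← sq, Finset.expect_sub_distrib, lowRunCount_div_eq_expect,
      Fintype.expect_const]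
  calc _ = 𝔼 i, 𝔼 j, 𝔼 π, X π i * X π j := by
        simp only [hsq]
        rw [Finset.expect_comm]
        exact Finset.expect_congr rfl fun i _ => Finset.expect_comm _ _ _
    _ ≤ _ := by
      refine expect_expect_le_add ?_ (fun i j => ?_) fun i j hi hj hij =>
        expect_lowRunIndicator_sub_mul_sub_le hmb hbn hi hj hij
      · have := collisionProb_nonneg K n
        have := collisionProb_nonneg (K + K) n
        positivity
      · exact Finset.expect_le Finset.univ_nonempty fun π _ => (le_abs_self _).trans
          ((abs_mul _ _).trans_le (mul_le_one₀ (hX π i) (abs_nonneg _) (hX π j)))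

theorem tendsto_expect_sq_lowRunCount_sub {m b : ℕ → ℕ} (hmb : ∀ n, m n ≤ b n)
    (hbn : ∀ n, b n ≤ n) :
    Tendsto (fun n => 𝔼 π : Equiv.Perm (Fin n),
      ((lowRunCount π (m n) (b n) : ℝ) / n - chainProb n (m n) (b n)) ^ 2) atTop (𝓝 0) := by
  refine tendsto_order.2 ⟨fun a ha => .of_forall fun n => ha.trans_le <|
    Finset.expect_nonneg fun π _ => sq_nonneg _, fun ε hε => ?_⟩
  have hfact : Tendsto (fun K : ℕ => (4 : ℝ) / K.factorial) atTop (𝓝 0) := by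
    simpa [div_eq_mul_inv] using
      (FloorSemiring.tendsto_pow_div_factorial_atTop (1 : ℝ)).const_mul 4
  obtain ⟨K, hK⟩ := (hfact.eventually_lt_const hε).exists
  have hbound : Tendsto (fun n : ℕ => 4 / K.factorial + 2 * collisionProb K n +
      collisionProb (K + K) n + 4 * K / n) atTop (𝓝 (4 / K.factorial + 2 * 0 + 0 + 0)) :=
    (((tendsto_collisionProb K).const_mul 2).const_add _ |>.add (tendsto_collisionProb (K + K))).add
      (tendsto_const_div_atTop_nhds_zero_nat _)
  filter_upwards [hbound.eventually_lt_const (by simpa using hK), eventually_ne_atTop 0] with n h hn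
  have : NeZero n := ⟨hn⟩
  exact (expect_sq_lowRunCount_sub_le (hmb n) (hbn n) K).trans_lt h

theorem tendsto_chainProb {m b : ℕ → ℕ} {s t : ℝ} (hmb : ∀ n, m n ≤ b n)
    (hm : Tendsto (fun n => (m n : ℝ) / n) atTop (𝓝 s))
    (hb : Tendsto (fun n => (b n : ℝ) / n) atTop (𝓝 t)) :
    Tendsto (fun n => chainProb n (m n) (b n)) atTop (𝓝 (s * Real.exp (t - s))) := by
  have hlog : Tendsto (fun n : ℕ => (n : ℝ) * Real.log (1 + 1 / n)) atTop (𝓝 1) :=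
    (Real.tendsto_mul_log_one_add_div_atTop 1).comp tendsto_natCast_atTop_atTop
  have hexp := hm.mul ((Real.continuous_exp.tendsto _).comp ((hb.sub hm).mul hlog))
  rw [mul_one] at hexp
  refine hexp.congr' ?_
  filter_upwards [eventually_ne_atTop 0] with n hn
  have hn' : (n : ℝ) ≠ 0 := Nat.cast_ne_zero.2 hn
  have hpow : Real.exp (((b n : ℝ) / n - m n / n) * (n * Real.log (1 + 1 / n))) =
      (1 + 1 / n) ^ (b n - m n) := by
    rw [← Real.exp_log (by positivity : (0 : ℝ) < (1 + 1 / n) ^ (b n - m n)), Real.log_pow,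
      Nat.cast_sub (hmb n)]
    field_simp
  rw [Function.comp_apply, hpow, chainProb, if_neg (hmb n).not_gt]

theorem tendsto_expect_abs_lowRunCount_sub {m b : ℕ → ℕ} {s t : ℝ} (hmb : ∀ n, m n ≤ b n)
    (hbn : ∀ n, b n ≤ n) (hm : Tendsto (fun n => (m n : ℝ) / n) atTop (𝓝 s))
    (hb : Tendsto (fun n => (b n : ℝ) / n) atTop (𝓝 t)) :
    Tendsto (fun n => 𝔼 π : Equiv.Perm (Fin n),
      |(lowRunCount π (m n) (b n) : ℝ) / n - s * Real.exp (t - s)|) atTop (𝓝 0) := by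
  have hsqrt := (Real.continuous_sqrt.tendsto _).comp (tendsto_expect_sq_lowRunCount_sub hmb hbn)
  have hprob := ((tendsto_chainProb hmb hm hb).sub_const (s * Real.exp (t - s))).abs
  have hbound := hsqrt.add hprob
  rw [Real.sqrt_zero, sub_self, abs_zero, add_zero] at hbound
  refine squeeze_zero (fun n => Finset.expect_nonneg fun π _ => abs_nonneg _) (fun n => ?_) hbound
  set q := chainProb n (m n) (b n)
  calc _ ≤ 𝔼 π : Equiv.Perm (Fin n), (|(lowRunCount π (m n) (b n) : ℝ) / n - q| +
          |q - s * Real.exp (t - s)|) :=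
        Finset.expect_le_expect fun π _ => abs_sub_le _ _ _
    _ = (𝔼 π : Equiv.Perm (Fin n), |(lowRunCount π (m n) (b n) : ℝ) / n - q|) +
        |q - s * Real.exp (t - s)| := by rw [Finset.expect_add_distrib, Fintype.expect_const]
    _ ≤ _ := by
      gcongr
      refine Real.le_sqrt_of_sq_le ?_
      simpa using Finset.expect_mul_sq_le_sq_mul_sq Finset.univ
        (fun π : Equiv.Perm (Fin n) => |(lowRunCount π (m n) (b n) : ℝ) / n - q|) 1

end Concentration

/-- The curve `C` is the graph `x = curve y`, `0 ≤ y ≤ 1`. -/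
noncomputable def curve (s : ℝ) : ℝ := s * Real.exp (1 - s)

theorem curve_mul_exp (s t : ℝ) : curve s * Real.exp (t - 1) = s * Real.exp (t - s) := by
  rw [curve, mul_assoc, ← Real.exp_add, sub_add_sub_cancel']

theorem curve_mul_exp_self (s : ℝ) : curve s * Real.exp (s - 1) = s := by
  simp [curve_mul_exp]

theorem curve_zero : curve 0 = 0 := by simp [curve]

theorem curve_one : curve 1 = 1 := by simp [curve]

theorem continuous_curve : Continuous curve := by
  unfold curve
  fun_prop

theorem strictMonoOn_curve : StrictMonoOn curve (Icc 0 1) := by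
  refine strictMonoOn_of_deriv_pos (convex_Icc 0 1) continuous_curve.continuousOn fun s hs => ?_
  rw [interior_Icc] at hs
  have hderiv : HasDerivAt curve (1 * Real.exp (1 - s) + s * (Real.exp (1 - s) * -1)) s :=
    (hasDerivAt_id s).mul ((hasDerivAt_id s).const_sub 1).exp
  rw [hderiv.deriv]
  nlinarith [hs.2, Real.exp_pos (1 - s)]

theorem curve_mem_Icc {s : ℝ} (hs : s ∈ Icc (0 : ℝ) 1) : curve s ∈ Icc (0 : ℝ) 1 := by
  have hmono := strictMonoOn_curve.monotoneOn
  constructor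
  · simpa only [curve_zero] using hmono (left_mem_Icc.2 zero_le_one) hs hs.1
  · simpa only [curve_one] using hmono hs (right_mem_Icc.2 zero_le_one) hs.2

theorem exists_curve_eq {x : ℝ} (hx : x ∈ Icc (0 : ℝ) 1) : ∃ s ∈ Icc (0 : ℝ) 1, curve s = x := by
  rw [← curve_zero, ← curve_one] at hx
  exact intermediate_value_Icc zero_le_one continuous_curve.continuousOn hx

theorem min_curve_mul_exp_of_le {s y : ℝ} (hs : s ∈ Icc (0 : ℝ) 1) (hy : y ∈ Icc (0 : ℝ) 1)
    (hys : y ≤ s) : min y (curve s * Real.exp (y - 1)) = y := by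
  refine min_eq_left ?_
  calc y = curve y * Real.exp (y - 1) := (curve_mul_exp_self y).symm
    _ ≤ curve s * Real.exp (y - 1) := by
      gcongr
      exact strictMonoOn_curve.monotoneOn hy hs hys

theorem min_curve_mul_exp_of_ge {s y : ℝ} (hs : s ∈ Icc (0 : ℝ) 1) (hy : y ∈ Icc (0 : ℝ) 1)
    (hsy : s ≤ y) : min y (curve s * Real.exp (y - 1)) = s * Real.exp (y - s) := by
  rw [← curve_mul_exp]
  refine min_eq_right ?_
  calc curve s * Real.exp (y - 1) ≤ curve y * Real.exp (y - 1) := by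
        gcongr
        exact strictMonoOn_curve.monotoneOn hs hy hsy
    _ = y := curve_mul_exp_self y

theorem floor_mul_natCast_le {t : ℝ} (ht : t ≤ 1) (n : ℕ) : ⌊t * n⌋₊ ≤ n :=
  Nat.floor_le_of_le (mul_le_of_le_one_left n.cast_nonneg ht)

theorem tendsto_floor_mul_div {t : ℝ} (ht : 0 ≤ t) :
    Tendsto (fun n : ℕ => (⌊t * n⌋₊ : ℝ) / n) atTop (𝓝 t) :=
  (tendsto_nat_floor_mul_div_atTop ht).comp tendsto_natCast_atTop_atTop

theorem tendsto_expect_abs_lowRunCount_sub_min {s y : ℝ} (hs : s ∈ Icc (0 : ℝ) 1)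
    (hy : y ∈ Icc (0 : ℝ) 1) :
    Tendsto (fun n : ℕ => 𝔼 π : Equiv.Perm (Fin n), |(lowRunCount π ⌊s * n⌋₊ ⌊y * n⌋₊ : ℝ) / n -
      min y (curve s * Real.exp (y - 1))|) atTop (𝓝 0) := by
  rcases le_total y s with hys | hsy
  · have hcount (n : ℕ) (π : Equiv.Perm (Fin n)) :
        lowRunCount π ⌊s * n⌋₊ ⌊y * n⌋₊ = ⌊y * n⌋₊ :=
      lowRunCount_of_le π (by gcongr) (floor_mul_natCast_le hy.2 n)
    simp only [min_curve_mul_exp_of_le hs hy hys, hcount, Fintype.expect_const]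
    simpa using ((tendsto_floor_mul_div hy.1).sub_const y).abs
  · rw [min_curve_mul_exp_of_ge hs hy hsy]
    exact tendsto_expect_abs_lowRunCount_sub (fun n => by gcongr)
      (floor_mul_natCast_le hy.2) (tendsto_floor_mul_div hs.1) (tendsto_floor_mul_div hy.1)

theorem tendsto_expect_abs_lowRunCount_sub_curve {s : ℝ} (hs : s ∈ Icc (0 : ℝ) 1) :
    Tendsto (fun n : ℕ => 𝔼 π : Equiv.Perm (Fin n), |(lowRunCount π ⌊s * n⌋₊ n : ℝ) / n - curve s|)
      atTop (𝓝 0) := by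
  have hone : Tendsto (fun n : ℕ => (n : ℝ) / n) atTop (𝓝 1) :=
    tendsto_const_nhds.congr' <| by
      filter_upwards [eventually_ne_atTop 0] with n hn
      exact (div_self (Nat.cast_ne_zero.2 hn)).symm
  exact tendsto_expect_abs_lowRunCount_sub (floor_mul_natCast_le hs.2) (fun _ => le_rfl)
    (tendsto_floor_mul_div hs.1) hone

theorem abs_runsortCount_div_sub_le {n : ℕ} (π : Equiv.Perm (Fin n)) (a m b : ℕ) (x z : ℝ) :
    |(runsortCount π a b : ℝ) / n - z| ≤
      |(lowRunCount π m b : ℝ) / n - z| + |(lowRunCount π m n : ℝ) / n - x| +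
        |(a : ℝ) / n - x| := by
  have hcount : |(runsortCount π a b : ℝ) / n - lowRunCount π m b / n| ≤
      |(a : ℝ) / n - lowRunCount π m n / n| := by
    rw [lowRunCount_eq_runsortCount, ← sub_div, ← sub_div, abs_div, abs_div]
    exact div_le_div_of_nonneg_right (abs_runsortCount_sub_le π _ _ b) (abs_nonneg _)
  have htri := abs_sub_le ((runsortCount π a b : ℝ) / n) (lowRunCount π m b / n) z
  have htri' := abs_sub_le ((a : ℝ) / n) x (lowRunCount π m n / n)
  rw [abs_sub_comm x] at htri'
  linarith

theorem tendsto_expect_runsortCount {x y : ℝ} (hx : x ∈ Icc (0 : ℝ) 1)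
    (hy : y ∈ Icc (0 : ℝ) 1) :
    Tendsto (fun n : ℕ => 𝔼 π : Equiv.Perm (Fin n), (runsortCount π ⌊x * n⌋₊ ⌊y * n⌋₊ : ℝ) / n)
      atTop (𝓝 (min y (x * Real.exp (y - 1)))) := by
  obtain ⟨s, hs, rfl⟩ := exists_curve_eq hx
  have herr := ((tendsto_expect_abs_lowRunCount_sub_min hs hy).add
    (tendsto_expect_abs_lowRunCount_sub_curve hs)).add
    ((tendsto_floor_mul_div hx.1).sub_const (curve s)).abs
  rw [sub_self, abs_zero, add_zero, add_zero] at herr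
  refine tendsto_iff_norm_sub_tendsto_zero.2
    (squeeze_zero (fun _ => norm_nonneg _) (fun n => ?_) herr)
  set z := min y (curve s * Real.exp (y - 1))
  calc |𝔼 π : Equiv.Perm (Fin n), (runsortCount π ⌊curve s * n⌋₊ ⌊y * n⌋₊ : ℝ) / n - z|
    _ = |𝔼 π : Equiv.Perm (Fin n), ((runsortCount π ⌊curve s * n⌋₊ ⌊y * n⌋₊ : ℝ) / n - z)| := by
      rw [Finset.expect_sub_distrib, Fintype.expect_const]
    _ ≤ 𝔼 π : Equiv.Perm (Fin n), (|(lowRunCount π ⌊s * n⌋₊ ⌊y * n⌋₊ : ℝ) / n - z| +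
          |(lowRunCount π ⌊s * n⌋₊ n : ℝ) / n - curve s| + |(⌊curve s * n⌋₊ : ℝ) / n - curve s|) :=
      (Finset.abs_expect_le _ _).trans
        (Finset.expect_le_expect fun π _ => abs_runsortCount_div_sub_le π _ _ _ _ z)
    _ = _ := by rw [Finset.expect_add_distrib, Finset.expect_add_distrib, Fintype.expect_const]

section LimitMeasure

theorem Iic_inter_Icc {α : Type*} [LinearOrder α] (a b c : α) :
    Iic c ∩ Icc a b = Icc a (min c b) := by
  rw [← Ici_inter_Iic, ← Ici_inter_Iic, inter_left_comm, Iic_inter_Iic]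

/-- The conditional distribution under `R` of the first coordinate, given that the second one is
`y ∈ [0, 1]`. -/
noncomputable def slice (y : ℝ) : Measure ℝ :=
  ENNReal.ofReal (Real.exp (y - 1)) • volume.restrict (Ico 0 (curve y)) +
    ENNReal.ofReal (1 - y) • Measure.dirac (curve y)

theorem slice_eq_one {y : ℝ} (hy : y ∈ Icc (0 : ℝ) 1) {A : Set ℝ} (hA : MeasurableSet A)
    (hsub : Icc 0 (curve y) ⊆ A) : slice y A = 1 := by
  have harea : volume (A ∩ Ico 0 (curve y)) = ENNReal.ofReal (curve y) := by
    rw [inter_eq_self_of_subset_right (Ico_subset_Icc_self.trans hsub), Real.volume_Ico, sub_zero]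
  have hcurve : curve y ∈ A := hsub (right_mem_Icc.2 (curve_mem_Icc hy).1)
  simp only [slice, Measure.add_apply, Measure.smul_apply, Measure.restrict_apply hA, harea,
    Measure.dirac_apply_of_mem hcurve, smul_eq_mul, mul_one]
  rw [← ENNReal.ofReal_mul (Real.exp_pos _).le, mul_comm, curve_mul_exp_self,
    ← ENNReal.ofReal_add hy.1 (sub_nonneg.2 hy.2), add_sub_cancel, ENNReal.ofReal_one]

theorem slice_Iic_of_lt {x y : ℝ} (hxy : x < curve y) :
    slice y (Iic x) = ENNReal.ofReal (x * Real.exp (y - 1)) := by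
  have hinter : Iic x ∩ Ico 0 (curve y) = Icc 0 x := by
    ext t
    simp only [mem_inter_iff, mem_Iic, mem_Ico, mem_Icc]
    grind
  have hcurve : curve y ∉ Iic x := not_le.2 hxy
  simp only [slice, Measure.add_apply, Measure.smul_apply, Measure.restrict_apply measurableSet_Iic,
    hinter, Measure.dirac_apply' _ measurableSet_Iic, indicator_of_notMem hcurve, smul_eq_mul,
    mul_zero, add_zero, Real.volume_Icc, sub_zero]
  rw [← ENNReal.ofReal_mul (Real.exp_pos _).le, mul_comm]

theorem mem_Cplus_iff {x y : ℝ} : (x, y) ∈ Cplus ↔ y ∈ Icc (0 : ℝ) 1 ∧ x ∈ Ico 0 (curve y) := by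
  constructor
  · rintro ⟨⟨hx, hy⟩, hxy⟩
    exact ⟨hy, hx.1, hxy⟩
  · rintro ⟨hy, hx, hxy⟩
    exact ⟨⟨⟨hx, hxy.le.trans (curve_mem_Icc hy).2⟩, hy⟩, hxy⟩

theorem measurableSet_Cplus : MeasurableSet Cplus :=
  (measurableSet_Icc.prod measurableSet_Icc).inter (measurableSet_lt measurable_fst (by fun_prop))

section Prod

variable {A B : Set ℝ}

theorem withDensity_Cplus_prod (hA : MeasurableSet A) (hB : MeasurableSet B) :
    (volume.restrict Cplus).withDensity (fun q => ENNReal.ofReal (Real.exp (q.2 - 1))) (A ×ˢ B) =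
      ∫⁻ y in B ∩ Icc 0 1,
        ENNReal.ofReal (Real.exp (y - 1)) * volume.restrict (Ico 0 (curve y)) A := by
  have hS : MeasurableSet (A ×ˢ B ∩ Cplus) := (hA.prod hB).inter measurableSet_Cplus
  have hdens : Measurable fun q : ℝ × ℝ => ENNReal.ofReal (Real.exp (q.2 - 1)) := by fun_prop
  have hind (x y : ℝ) :
      (A ×ˢ B ∩ Cplus).indicator (fun q => ENNReal.ofReal (Real.exp (q.2 - 1))) (x, y) =
        (B ∩ Icc 0 1).indicator (fun y => (A ∩ Ico 0 (curve y)).indicator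
          (fun _ => ENNReal.ofReal (Real.exp (y - 1))) x) y := by
    classical
    simp only [indicator_apply, mem_inter_iff, prodMk_mem_set_prod_eq, mem_Cplus_iff]
    grind
  rw [withDensity_apply _ (hA.prod hB), Measure.restrict_restrict (hA.prod hB),
    ← lintegral_indicator hS, Measure.volume_eq_prod,
    lintegral_prod_symm _ (hdens.indicator hS).aemeasurable,
    ← lintegral_indicator (hB.inter measurableSet_Icc)]
  refine lintegral_congr fun y => ?_
  simp only [hind]
  by_cases hy : y ∈ B ∩ Icc (0 : ℝ) 1
  · simp only [indicator_of_mem hy, lintegral_indicator (hA.inter measurableSet_Ico),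
      setLIntegral_const, Measure.restrict_apply hA]
  · simp only [indicator_of_notMem hy, lintegral_zero]

theorem map_withDensity_curve_prod (hA : MeasurableSet A) (hB : MeasurableSet B) :
    ((volume.restrict (Icc (0 : ℝ) 1)).withDensity fun y => ENNReal.ofReal (1 - y)).map
        (fun y => (curve y, y)) (A ×ˢ B) =
      ∫⁻ y in B ∩ Icc 0 1, ENNReal.ofReal (1 - y) * Measure.dirac (curve y) A := by
  have hgraph : Measurable fun y => (curve y, y) := continuous_curve.measurable.prodMk measurable_id
  have hpre : MeasurableSet ((fun y => (curve y, y)) ⁻¹' A ×ˢ B) := hgraph (hA.prod hB)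
  rw [Measure.map_apply hgraph (hA.prod hB), withDensity_apply _ hpre,
    Measure.restrict_restrict hpre, ← lintegral_indicator (hpre.inter measurableSet_Icc),
    ← lintegral_indicator (hB.inter measurableSet_Icc)]
  refine lintegral_congr fun y => ?_
  classical
  simp only [indicator_apply, Measure.dirac_apply' _ hA, mem_inter_iff, mem_preimage,
    prodMk_mem_set_prod_eq, Pi.one_apply, mul_ite, mul_one, mul_zero]
  grind

theorem R_prod (hA : MeasurableSet A) (hB : MeasurableSet B) :
    R (A ×ˢ B) = ∫⁻ y in B ∩ Icc 0 1, slice y A := by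
  have hmeas : Measurable fun y => ENNReal.ofReal (1 - y) * Measure.dirac (curve y) A := by
    refine .mul (by fun_prop) ?_
    simp only [Measure.dirac_apply' _ hA]
    exact (measurable_one.indicator hA).comp continuous_curve.measurable
  simp only [slice, Measure.add_apply, Measure.smul_apply, smul_eq_mul]
  rw [lintegral_add_right _ hmeas, ← withDensity_Cplus_prod hA hB,
    ← map_withDensity_curve_prod hA hB]
  rfl

theorem R_prod_of_Icc_curve_subset (hA : MeasurableSet A) (hB : MeasurableSet B)
    (hsub : ∀ y ∈ B ∩ Icc 0 1, Icc 0 (curve y) ⊆ A) :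
    R (A ×ˢ B) = volume (B ∩ Icc 0 1) := by
  rw [R_prod hA hB, ← setLIntegral_one]
  exact setLIntegral_congr_fun (hB.inter measurableSet_Icc) fun y hy =>
    slice_eq_one hy.2 hA (hsub y hy)

end Prod

theorem R_Iic_prod_Iic_of_le {s y : ℝ} (hs : s ∈ Icc (0 : ℝ) 1) (hys : y ≤ s) :
    R (Iic (curve s) ×ˢ Iic y) = ENNReal.ofReal y := by
  rw [R_prod_of_Icc_curve_subset measurableSet_Iic measurableSet_Iic fun t ht =>
    Icc_subset_Iic_self.trans (Iic_subset_Iic.2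
      (strictMonoOn_curve.monotoneOn ht.2 hs (ht.1.trans hys)))]
  have hinter : Iic y ∩ Icc (0 : ℝ) 1 = Icc 0 y := by
    rw [Iic_inter_Icc, min_eq_left (hys.trans hs.2)]
  rw [hinter, Real.volume_Icc, sub_zero]

theorem integral_mul_exp_sub (s y : ℝ) :
    ∫ t in s..y, s * Real.exp (t - s) = s * Real.exp (y - s) - s := by
  simp [intervalIntegral.integral_comp_sub_right, mul_sub]

theorem R_Iic_prod_Ioc {s y : ℝ} (hs : s ∈ Icc (0 : ℝ) 1) (hy : y ≤ 1) (hsy : s ≤ y) :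
    R (Iic (curve s) ×ˢ Ioc s y) = ENNReal.ofReal (s * Real.exp (y - s) - s) := by
  have hinter : Ioc s y ∩ Icc (0 : ℝ) 1 = Ioc s y :=
    inter_eq_self_of_subset_left (Ioc_subset_Icc_self.trans (Icc_subset_Icc hs.1 hy))
  have hslice : ∀ t ∈ Ioc s y, slice t (Iic (curve s)) = ENNReal.ofReal (s * Real.exp (t - s)) := by
    intro t ht
    rw [slice_Iic_of_lt (strictMonoOn_curve hs ⟨hs.1.trans ht.1.le, ht.2.trans hy⟩ ht.1),
      curve_mul_exp]
  have hcont : Continuous fun t => s * Real.exp (t - s) := by fun_prop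
  rw [R_prod measurableSet_Iic measurableSet_Ioc, hinter,
    setLIntegral_congr_fun measurableSet_Ioc hslice, ← ofReal_integral_eq_lintegral_ofReal,
    ← intervalIntegral.integral_of_le hsy, integral_mul_exp_sub]
  · exact hcont.integrableOn_Ioc
  · exact .of_forall fun t => mul_nonneg hs.1 (Real.exp_pos _).le

theorem R_Iic_prod_Iic {x y : ℝ} (hx : x ∈ Icc (0 : ℝ) 1) (hy : y ∈ Icc (0 : ℝ) 1) :
    R (Iic x ×ˢ Iic y) = ENNReal.ofReal (min y (x * Real.exp (y - 1))) := by
  obtain ⟨s, hs, rfl⟩ := exists_curve_eq hx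
  rcases le_total y s with hys | hsy
  · rw [R_Iic_prod_Iic_of_le hs hys, min_curve_mul_exp_of_le hs hy hys]
  · have hdisj : Disjoint (Iic (curve s) ×ˢ Iic s) (Iic (curve s) ×ˢ Ioc s y) :=
      Set.disjoint_prod.2 (.inr (Iic_disjoint_Ioc le_rfl))
    have hnonneg : 0 ≤ s * Real.exp (y - s) - s :=
      sub_nonneg.2 (le_mul_of_one_le_right hs.1 (Real.one_le_exp (sub_nonneg.2 hsy)))
    rw [← Iic_union_Ioc_eq_Iic hsy, prod_union,
      measure_union hdisj (measurableSet_Iic.prod measurableSet_Ioc),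
      R_Iic_prod_Iic_of_le hs le_rfl, R_Iic_prod_Ioc hs hy.2 hsy, ← ENNReal.ofReal_add hs.1 hnonneg,
      add_sub_cancel, min_curve_mul_exp_of_ge hs hy hsy]

theorem R_Iic_prod_univ (x : ℝ) : R (Iic x ×ˢ univ) = volume (Iic x ∩ Icc 0 1) := by
  rcases lt_or_ge x 0 with hneg | hnonneg
  · have hslice : ∀ t ∈ univ ∩ Icc (0 : ℝ) 1, slice t (Iic x) = 0 := fun t ht => by
      rw [slice_Iic_of_lt (hneg.trans_le (curve_mem_Icc ht.2).1)]
      exact ENNReal.ofReal_of_nonpos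
        (mul_nonpos_of_nonpos_of_nonneg hneg.le (Real.exp_pos _).le)
    have hinter : Iic x ∩ Icc (0 : ℝ) 1 = ∅ := by
      rw [Iic_inter_Icc, Icc_eq_empty (by simp [hneg])]
    rw [R_prod measurableSet_Iic .univ,
      setLIntegral_congr_fun (MeasurableSet.univ.inter measurableSet_Icc) hslice, lintegral_zero,
      hinter, measure_empty]
  rcases le_total x 1 with hle | hge
  · have hIic : R (Iic x ×ˢ univ) = R (Iic x ×ˢ Iic 1) := by
      rw [R_prod measurableSet_Iic .univ, R_prod measurableSet_Iic measurableSet_Iic, univ_inter,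
        inter_eq_self_of_subset_right Icc_subset_Iic_self]
    rw [hIic, R_Iic_prod_Iic ⟨hnonneg, hle⟩ (right_mem_Icc.2 zero_le_one),
      Iic_inter_Icc, min_comm, Real.volume_Icc, sub_self, Real.exp_zero, mul_one, sub_zero]
  · rw [R_prod_of_Icc_curve_subset measurableSet_Iic .univ fun y hy =>
      Icc_subset_Iic_self.trans (Iic_subset_Iic.2 ((curve_mem_Icc hy.2).2.trans hge)), univ_inter,
      inter_eq_self_of_subset_right (Icc_subset_Iic_self.trans (Iic_subset_Iic.2 hge))]

theorem isPermuton_R : IsPermuton R := by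
  have hsnd : R.map Prod.snd = volume.restrict (Icc (0 : ℝ) 1) := by
    ext B hB
    rw [Measure.map_apply measurable_snd hB, ← univ_prod,
      R_prod_of_Icc_curve_subset .univ hB fun _ _ => subset_univ _, Measure.restrict_apply hB]
  have : IsFiniteMeasure R :=
    ⟨by simp [← univ_prod_univ,
      R_prod_of_Icc_curve_subset .univ .univ fun _ _ => subset_univ _]⟩
  have := Measure.isFiniteMeasure_map R Prod.fst
  refine ⟨⟨measurable_fst, Measure.ext_of_Iic _ _ fun x => ?_⟩, measurable_snd, hsnd⟩
  rw [Measure.map_apply measurable_fst measurableSet_Iic, ← prod_univ, R_Iic_prod_univ,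
    Measure.restrict_apply measurableSet_Iic]

theorem jointCdf_R {x y : ℝ} (hx : x ∈ Icc (0 : ℝ) 1) (hy : y ∈ Icc (0 : ℝ) 1) :
    jointCdf R x y = min y (x * Real.exp (y - 1)) := by
  rw [jointCdf, Measure.real, R_Iic_prod_Iic hx hy, ENNReal.toReal_ofReal]
  exact le_min hy.1 (mul_nonneg hx.1 (Real.exp_pos _).le)

end LimitMeasure

section Convergence

theorem abs_sub_floor_mul_div_le {n : ℕ} [NeZero n] {t : ℝ} (ht : 0 ≤ t) :
    |t - (⌊t * n⌋₊ : ℝ) / n| ≤ 1 / n := by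
  have hn : (0 : ℝ) < n := Nat.cast_pos.2 n.pos_of_neZero
  have hdiv : t - (⌊t * n⌋₊ : ℝ) / n = (t * n - ⌊t * n⌋₊) / n := by field_simp
  have hle := Nat.floor_le (mul_nonneg ht hn.le)
  rw [hdiv, abs_of_nonneg (div_nonneg (sub_nonneg.2 hle) hn.le)]
  gcongr
  linarith [Nat.lt_floor_add_one (t * n)]

theorem abs_jointCdf_meanMeasure_sub_le (n : ℕ) [NeZero n] {x y : ℝ} (hx : 0 ≤ x) (hy : 0 ≤ y) :
    |jointCdf (meanMeasure n) x y -
      𝔼 π : Equiv.Perm (Fin n), (runsortCount π ⌊x * n⌋₊ ⌊y * n⌋₊ : ℝ) / n| ≤ 2 / n := by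
  rw [← jointCdf_meanMeasure]
  calc _ ≤ |x - (⌊x * n⌋₊ : ℝ) / n| + |y - (⌊y * n⌋₊ : ℝ) / n| :=
        (isPermuton_meanMeasure n).abs_jointCdf_sub_le _ _ _ _
    _ ≤ 1 / n + 1 / n := add_le_add (abs_sub_floor_mul_div_le hx) (abs_sub_floor_mul_div_le hy)
    _ = 2 / n := by ring

theorem tendsto_jointCdf_meanMeasure {x y : ℝ} (hx : x ∈ Icc (0 : ℝ) 1) (hy : y ∈ Icc (0 : ℝ) 1) :
    Tendsto (fun n => jointCdf (meanMeasure n) x y) atTop (𝓝 (jointCdf R x y)) := by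
  have hdiff : Tendsto (fun n : ℕ => jointCdf (meanMeasure n) x y -
      𝔼 π : Equiv.Perm (Fin n), (runsortCount π ⌊x * n⌋₊ ⌊y * n⌋₊ : ℝ) / n) atTop (𝓝 0) := by
    refine squeeze_zero_norm' ?_ (tendsto_const_div_atTop_nhds_zero_nat (2 : ℝ))
    filter_upwards [eventually_ne_atTop 0] with n hn
    have : NeZero n := ⟨hn⟩
    exact abs_jointCdf_meanMeasure_sub_le n hx.1 hy.1
  rw [jointCdf_R hx hy]
  simpa only [sub_add_cancel, zero_add] using hdiff.add (tendsto_expect_runsortCount hx hy)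

theorem tendsto_dSquare_meanMeasure : Tendsto (fun n => dSquare (meanMeasure n) R) atTop (𝓝 0) :=
  (tendsto_add_atTop_iff_nat 1).1 <|
    isPermuton_R.tendsto_dSquare (fun n => isPermuton_meanMeasure (n + 1)) fun _ hx _ hy =>
      (tendsto_add_atTop_iff_nat 1).2 (tendsto_jointCdf_meanMeasure hx hy)

variable {x₁ x₂ y₁ y₂ : ℝ}

theorem tendsto_real_meanMeasure (hx₁ : x₁ ∈ Icc (0 : ℝ) 1) (hx₂ : x₂ ∈ Icc (0 : ℝ) 1)
    (hx : x₁ ≤ x₂) (hy₁ : y₁ ∈ Icc (0 : ℝ) 1) (hy₂ : y₂ ∈ Icc (0 : ℝ) 1) (hy : y₁ ≤ y₂) :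
    Tendsto (fun n => (meanMeasure n).real (Icc x₁ x₂ ×ˢ Icc y₁ y₂)) atTop
      (𝓝 (R.real (Icc x₁ x₂ ×ˢ Icc y₁ y₂))) := by
  rw [isPermuton_R.real_Icc_prod_Icc hx hy]
  refine ((((tendsto_jointCdf_meanMeasure hx₂ hy₂).sub (tendsto_jointCdf_meanMeasure hx₁ hy₂)).sub
    (tendsto_jointCdf_meanMeasure hx₂ hy₁)).add (tendsto_jointCdf_meanMeasure hx₁ hy₁)).congr' ?_
  filter_upwards [eventually_ne_atTop 0] with n hn
  have : NeZero n := ⟨hn⟩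
  rw [(isPermuton_meanMeasure n).real_Icc_prod_Icc hx hy]

theorem tendsto_E (hx₁ : x₁ ∈ Icc (0 : ℝ) 1) (hx₂ : x₂ ∈ Icc (0 : ℝ) 1)
    (hx : x₁ ≤ x₂) (hy₁ : y₁ ∈ Icc (0 : ℝ) 1) (hy₂ : y₂ ∈ Icc (0 : ℝ) 1) (hy : y₁ ≤ y₂) :
    Tendsto (fun n => E n x₁ x₂ y₁ y₂) atTop (𝓝 (R.real (Icc x₁ x₂ ×ˢ Icc y₁ y₂))) := by
  rw [isPermuton_R.real_Icc_prod_Icc hx hy, jointCdf_R hx₂ hy₂, jointCdf_R hx₁ hy₂,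
    jointCdf_R hx₂ hy₁, jointCdf_R hx₁ hy₁]
  simp only [E_eq _ hx₁.1 hx hy₁.1 hy]
  exact (((tendsto_expect_runsortCount hx₂ hy₂).sub (tendsto_expect_runsortCount hx₁ hy₂)).sub
    (tendsto_expect_runsortCount hx₂ hy₁)).add (tendsto_expect_runsortCount hx₁ hy₁)

end Convergence

end RunsortPermuton

theorem theorem2p5 :
    (∀ x₁ x₂ y₁ y₂ : ℝ, 0 ≤ x₁ → x₁ ≤ x₂ → x₂ ≤ 1 → 0 ≤ y₁ → y₁ ≤ y₂ → y₂ ≤ 1 →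
      Filter.Tendsto (fun n : ℕ => RunsortPermuton.E n x₁ x₂ y₁ y₂) Filter.atTop
        (nhds (RunsortPermuton.R.real (Set.Icc x₁ x₂ ×ˢ Set.Icc y₁ y₂))) ∧
      Filter.Tendsto
        (fun n : ℕ => (RunsortPermuton.meanMeasure n).real (Set.Icc x₁ x₂ ×ˢ Set.Icc y₁ y₂))
        Filter.atTop
        (nhds (RunsortPermuton.R.real (Set.Icc x₁ x₂ ×ˢ Set.Icc y₁ y₂)))) ∧
    Filter.Tendsto
      (fun n : ℕ => RunsortPermuton.dSquare (RunsortPermuton.meanMeasure n) RunsortPermuton.R)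
      Filter.atTop (nhds 0) := by
  refine ⟨fun x₁ x₂ y₁ y₂ hx₁ hx hx₂ hy₁ hy hy₂ => ?_, RunsortPermuton.tendsto_dSquare_meanMeasure⟩
  have hx₁' : x₁ ∈ Set.Icc (0 : ℝ) 1 := ⟨hx₁, hx.trans hx₂⟩
  have hx₂' : x₂ ∈ Set.Icc (0 : ℝ) 1 := ⟨hx₁.trans hx, hx₂⟩
  have hy₁' : y₁ ∈ Set.Icc (0 : ℝ) 1 := ⟨hy₁, hy.trans hy₂⟩
  have hy₂' : y₂ ∈ Set.Icc (0 : ℝ) 1 := ⟨hy₁.trans hy, hy₂⟩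
  exact ⟨RunsortPermuton.tendsto_E hx₁' hx₂' hx hy₁' hy₂' hy,
    RunsortPermuton.tendsto_real_meanMeasure hx₁' hx₂' hx hy₁' hy₂' hy⟩
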